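/- **Setting.** Let $\theta_0\in\mathbb R^d$, let $\Sigma_0\in\mathbb R^{d\times d}$ be symmetric positive definite and let $\sigma>0$. Let $\mathcal A\subseteq\mathbb R^d$ be a bounded set of actions and let $\mathcal A_t\subseteq\mathcal A$, $t=1,\dots,n$, be fixed sets of feasible actions. The model parameter is random, $\theta_*\sim\mathcal N(\theta_0,\Sigma_0)$. In round $t$ the agent takes an action $A_t\in\mathcal A_t$ and observes the reward $Y_t=A_t^\top\theta_*+\varepsilon_t$, where $\varepsilon_t\sim\mathcal N(0,\sigma^2)$ is independent of $\theta_*$, of the history $H_t=(A_\ell,Y_\ell)_{\ell<t}$ and of $A_t$. Put $$\hat\Sigma_t^{-1}=\Sigma_0^{-1}+\sigma^{-2}\sum_{\ell=1}^{t-1}A_\ell A_\ell^\top,\qquad \hat\theta_t=\hat\Sigma_t\Big(\Sigma_0^{-1}\theta_0+\sigma^{-2}\sum_{\ell=1}^{t-1}Y_\ell A_\ell\Big),\qquad \|a\|_M=\sqrt{a^\top M a}.$$ Let $A_{t,*}\in\arg\max_{a\in\mathcal A_t}a^\top\theta_*$ almost surely (the maximum is assumed to be attained), and let $$R(n)=\mathbb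 E\Big[\sum_{t=1}^n\big(A_{t,*}^\top\theta_*-A_t^\top\theta_*\big)\Big]$$ be the $n$-round Bayes regret. *LinTS* samples, in each round $t$, $\theta_t\sim\mathcal N(\hat\theta_t,\hat\Sigma_t)$ given $H_t$, and takes $A_t\in\arg\max_{a\in\mathcal A_t}a^\top\theta_t$. *Bayesian LinUCB* with parameter $\alpha$ takes $A_t\in\arg\max_{a\in\mathcal A_t}\big(a^\top\hat\theta_t+\alpha\|a\|_{\hat\Sigma_t}\big)$. In both algorithms the maxima are attained almost surely, and sampling and tie-breaking are conditionally independent of $\theta_*$ given $H_t$. Let $$\sigma_{\max}=\sup_{a\in\mathcal A,\;1\le t\le n}\|a\|_{\hat\Sigma_t}.$$ **Theorem.** Let $\delta>0$. For LinTS, and for Bayesian LinUCB with $\alpha=\sqrt{2d\log(1/\delta)}$, the regret is integrable and $$R(n)\le\sigma_{\max}\,d\,\sqrt{\frac{2n}{\log(1+\sigma^{-2}\sigma_{\max}^2)}\log\Big(1+\frac{\sigma_{\max}^2n}{\sigma^2d}\Big)\log(1/\delta)}+\sqrt{2/\pi}\;\sigma_{\max}\,d^{3/2}\,n\,\delta .$$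 Moreover, if $|\mathcal A_t|\le K$ for all $t\le n$, then for LinTS, and for Bayesian LinUCB with $\alpha=\sqrt{2\log(1/\delta)}$, the regret is integrable and $$R(n)\le\sigma_{\max}\sqrt{\frac{2dn}{\log(1+\sigma^{-2}\sigma_{\max}^2)}\log\Big(1+\frac{\sigma_{\max}^2n}{\sigma^2d}\Big)\log(1/\delta)}+\sqrt{2/\pi}\;\sigma_{\max}\,K\,n\,\delta .$$ Since $\hat\Sigma_t$ is random, each bound is asserted with $\sigma_{\max}$ evaluated at any outcome whatsoever. Square roots of negative numbers, which occur only for $\delta>1$, are read as $0$, and the first term of each bound is read as $0$ if $\sigma_{\max}=0$. -/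

import Mathlib

open MeasureTheory ProbabilityTheory

noncomputable section

namespace BayesLinBandit

/-- The space `ℝ^d` of actions and of model parameters, with its Euclidean inner product. -/
abbrev Vec (d : ℕ) : Type := EuclideanSpace ℝ (Fin d)

/-- A list of `t` (action, reward) pairs: what the agent has seen at the beginning of a round
that is preceded by `t` rounds.  Rounds are numbered `0, 1, 2, …`. -/
abbrev Hist (d t : ℕ) : Type := Fin t → Vec d × ℝ

/-- The weighted norm `‖a‖_M = √(aᵀ M a)`. -/
def wnorm {d : ℕ} (M : Matrix (Fin d) (Fin d) ℝ) (a : Vec d) : ℝ :=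
  Real.sqrt (a.ofLp ⬝ᵥ M.mulVec a.ofLp)

/-- The posterior covariance after the history `h`: the inverse of
`Σ₀⁻¹ + σ⁻² ∑ ℓ, A_ℓ A_ℓᵀ`. -/
def postCov {d t : ℕ} (Sig0 : Matrix (Fin d) (Fin d) ℝ) (σ : ℝ) (h : Hist d t) :
    Matrix (Fin d) (Fin d) ℝ :=
  (Sig0⁻¹ + (σ ^ 2)⁻¹ • ∑ l, Matrix.vecMulVec (h l).1.ofLp (h l).1.ofLp)⁻¹

/-- The posterior mean after the history `h`: the posterior covariance applied to
`Σ₀⁻¹ θ₀ + σ⁻² ∑ ℓ, Y_ℓ A_ℓ`. -/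
def postMean {d t : ℕ} (theta0 : Vec d) (Sig0 : Matrix (Fin d) (Fin d) ℝ) (σ : ℝ)
    (h : Hist d t) : Vec d :=
  WithLp.toLp 2 ((postCov Sig0 σ h).mulVec
    (Sig0⁻¹.mulVec theta0.ofLp + (σ ^ 2)⁻¹ • ∑ l, (h l).2 • (h l).1.ofLp))

/-- The posterior `N(postMean, postCov)` after the history `h`. -/
def posterior {d t : ℕ} (theta0 : Vec d) (Sig0 : Matrix (Fin d) (Fin d) ℝ) (σ : ℝ)
    (h : Hist d t) : Measure (Vec d) :=
  multivariateGaussian (postMean theta0 Sig0 σ h) (postCov Sig0 σ h)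

/-- `a ∈ argmax_{b ∈ S} f b`. -/
def IsArgmax {d : ℕ} (S : Set (Vec d)) (f : Vec d → ℝ) (a : Vec d) : Prop :=
  a ∈ S ∧ IsMaxOn f S a

variable {Ω : Type*} [MeasurableSpace Ω] {d : ℕ}

/-- The history at the beginning of round `t`: the actions and rewards of the earlier rounds. -/
def history (A : ℕ → Ω → Vec d) (Y : ℕ → Ω → ℝ) (t : ℕ) (ω : Ω) : Hist d t :=
  fun l => (A l ω, Y l ω)

/-- `n` rounds of a `d`-dimensional Bayesian linear bandit with prior `N(theta0, Sig0)` for the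
model parameter `θs`, actions `A t` from the feasible sets `F t`, noise `ε t ∼ N(0, σ²)` and
rewards `Y t = ⟪A t, θs⟫ + ε t`.  The noise of a round is independent of the model parameter,
of the history of the round and of the action taken in it. -/
structure IsLinearBandit (μ : Measure Ω) (n : ℕ) (theta0 : Vec d)
    (Sig0 : Matrix (Fin d) (Fin d) ℝ) (σ : ℝ) (F : ℕ → Set (Vec d))
    (θs : Ω → Vec d) (A : ℕ → Ω → Vec d) (Y ε : ℕ → Ω → ℝ) : Prop where
  measurable_param : Measurable θs
  measurable_action : ∀ t < n, Measurable (A t)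
  measurable_noise : ∀ t < n, Measurable (ε t)
  prior : μ.map θs = multivariateGaussian theta0 Sig0
  action_mem : ∀ t < n, ∀ᵐ ω ∂μ, A t ω ∈ F t
  noise_law : ∀ t < n, μ.map (ε t) = gaussianReal 0 (σ ^ 2).toNNReal
  noise_indep : ∀ t < n, IndepFun (ε t) (fun ω => (θs ω, history A Y t ω, A t ω)) μ
  reward : ∀ t < n, ∀ ω, Y t ω = inner ℝ (A t ω) (θs ω) + ε t ω

/-- The agent runs LinTS: in each round `t < n` it samples `θt t` from the posterior and takes an
action that maximizes `⟪a, θt t⟫` over `F t`.  Sampling and tie-breaking may only use the history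
and randomness of the agent's own: the conditional law of `(θt t, A t)` given the model parameter
and the history is a kernel `κ` of the history alone, whose first marginal is the posterior. -/
def IsLinTS (μ : Measure Ω) (n : ℕ) (theta0 : Vec d)
    (Sig0 : Matrix (Fin d) (Fin d) ℝ) (σ : ℝ) (F : ℕ → Set (Vec d))
    (θs : Ω → Vec d) (A : ℕ → Ω → Vec d) (Y : ℕ → Ω → ℝ) : Prop :=
  ∃ θt : ℕ → Ω → Vec d, ∀ t < n,
    Measurable (θt t) ∧
    (∃ κ : Kernel (Hist d t) (Vec d × Vec d), IsMarkovKernel κ ∧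
      (∀ h, (κ h).map Prod.fst = posterior theta0 Sig0 σ h) ∧
      HasCondDistrib (fun ω => (θt t ω, A t ω)) (fun ω => (θs ω, history A Y t ω))
        (Kernel.prodMkLeft (Vec d) κ) μ) ∧
    ∀ᵐ ω ∂μ, IsArgmax (F t) (fun a => inner ℝ a (θt t ω)) (A t ω)

/-- The upper confidence bound `U(a) = ⟪a, postMean⟫ + α ‖a‖_postCov` after the history `h`. -/
def ucb {t : ℕ} (theta0 : Vec d) (Sig0 : Matrix (Fin d) (Fin d) ℝ) (σ α : ℝ)
    (h : Hist d t) (a : Vec d) : ℝ :=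
  inner ℝ a (postMean theta0 Sig0 σ h) + α * wnorm (postCov Sig0 σ h) a

/-- The agent runs Bayesian LinUCB with parameter `α`: in each round `t < n` it takes an action
that maximizes the upper confidence bound over `F t`.  Ties may be broken in any way that only
uses the history and randomness of the agent's own: the conditional law of `A t` given the model
parameter and the history is a kernel of the history alone. -/
def IsLinUCB (μ : Measure Ω) (n : ℕ) (theta0 : Vec d)
    (Sig0 : Matrix (Fin d) (Fin d) ℝ) (σ α : ℝ) (F : ℕ → Set (Vec d))
    (θs : Ω → Vec d) (A : ℕ → Ω → Vec d) (Y : ℕ → Ω → ℝ) : Prop :=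
  ∀ t < n,
    (∃ κ : Kernel (Hist d t) (Vec d), IsMarkovKernel κ ∧
      HasCondDistrib (A t) (fun ω => (θs ω, history A Y t ω))
        (Kernel.prodMkLeft (Vec d) κ) μ) ∧
    ∀ᵐ ω ∂μ, IsArgmax (F t) (ucb theta0 Sig0 σ α (history A Y t ω)) (A t ω)

/-- The regret of `n` rounds in the outcome `ω`; `Astar t` is an optimal action of round `t`. -/
def regret (n : ℕ) (θs : Ω → Vec d) (Astar A : ℕ → Ω → Vec d) (ω : Ω) : ℝ :=
  ∑ t ∈ Finset.range n, (inner ℝ (Astar t ω) (θs ω) - inner ℝ (A t ω) (θs ω))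

/-- `σ_max`, the maximum of `‖a‖` in the norm of the posterior covariance of round `t`, over the
actions `a ∈ 𝒜` and the rounds `t < n`, in the outcome `ω`. -/
def sigmaMax (n : ℕ) (Sig0 : Matrix (Fin d) (Fin d) ℝ) (σ : ℝ) (𝒜 : Set (Vec d))
    (A : ℕ → Ω → Vec d) (Y : ℕ → Ω → ℝ) (ω : Ω) : ℝ :=
  sSup {x : ℝ | ∃ a ∈ 𝒜, ∃ t < n, x = wnorm (postCov Sig0 σ (history A Y t ω)) a}

end BayesLinBandit

end

/-!
# Bayes regret of LinTS and Bayesian LinUCB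

The posterior `N(θ̂, Σ̂)` is the conditional law of the parameter `θ` given the history, and it
stays so when the action of the round is revealed too, because the action depends on the history
and on independent randomness only (`IsLinearBandit.hasCondDistrib_history`,
`IsLinearBandit.hasCondDistrib_action`).  This is an induction over the rounds; the step is Bayes'
rule for one noisy linear observation of a Gaussian vector, an identity of two laws of (reward,
parameter) that is checked on characteristic functions (`gaussian_linear_observation`).

Hence the reward of the action `A` of a round has the same mean as `⟪A, θ̂⟫`, and the regret of the
round has the mean of `M(θ) - ⟪A, θ̂⟫`, where `M(x) = sup_a ⟪a, x⟫`.  Given the history, `M(θ)` may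
be replaced by `M(X)` for any `X` that follows the posterior.  For LinTS take the sample
`X = θ_t`, for which `M(X) = ⟪A, X⟫`; for LinUCB take `X = θ`.  Up to a tail term `T`, the excess of
`⟪a, X - θ̂⟫` over `α ‖a‖` with the norm of `Σ̂`, both give `M(X) ≤ ⟪A, θ̂⟫ + α ‖A‖ + T`
(`IsOptimistic`).  In this form neither the uniqueness of maximizers nor the measurability of the
optimal action is needed.

The tail has mean at most `√(2/π) σ_max d^{3/2} δ`, by Cauchy-Schwarz and a bound for each
coordinate of the standardized parameter (`exists_isTailBound_bounded`), and at most
`√(2/π) σ_max K δ` for `K` actions, by a union bound (`exists_isTailBound_finite`).  The widths `‖A‖` are summed pathwise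
by the elliptical potential lemma (`sum_sq_wnorm_le`): `∑ log (1 + σ⁻² ‖A‖²)` telescopes to a ratio
of determinants of precision matrices, and the arithmetic-geometric mean inequality for eigenvalues
bounds the latter.

The random `σ_max` is in fact deterministic: the posterior covariance never exceeds the prior
covariance, which is the covariance of the first round.  Only the upper bound on the widths is
needed (`wnorm_le_sigmaMax`).
-/

noncomputable section

namespace BayesLinBandit

open scoped Matrix

/-! ### Rank-one updates of a precision matrix -/

section RankOne

variable {d : ℕ} {V : Matrix (Fin d) (Fin d) ℝ}

lemma posDef_add_smul_vecMulVec (hV : V.PosDef) {r : ℝ} (hr : 0 ≤ r) (a : Fin d → ℝ) :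
    (V + r • Matrix.vecMulVec a a).PosDef := by
  refine hV.add_posSemidef (Matrix.PosSemidef.smul ?_ hr)
  simpa using Matrix.posSemidef_vecMulVec_self_star a

lemma inv_mulVec_mulVec (hV : V.PosDef) (x : Fin d → ℝ) : V⁻¹ *ᵥ (V *ᵥ x) = x := by
  rw [Matrix.mulVec_mulVec, Matrix.nonsing_inv_mul _ ((Matrix.isUnit_iff_isUnit_det _).1 hV.isUnit),
    Matrix.one_mulVec]

lemma mulVec_inv_mulVec (hV : V.PosDef) (x : Fin d → ℝ) : V *ᵥ (V⁻¹ *ᵥ x) = x := by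
  rw [Matrix.mulVec_mulVec, Matrix.mul_nonsing_inv _ ((Matrix.isUnit_iff_isUnit_det _).1 hV.isUnit),
    Matrix.one_mulVec]

lemma dotProduct_mulVec_comm {S : Matrix (Fin d) (Fin d) ℝ} (hS : S.IsHermitian)
    (x y : Fin d → ℝ) : x ⬝ᵥ S *ᵥ y = y ⬝ᵥ S *ᵥ x := by
  rw [Matrix.dotProduct_mulVec, ← Matrix.mulVec_transpose, dotProduct_comm]
  congr 2

/-- The identity `(V + r a aᵀ)⁻¹ (V + r a aᵀ) S u = S u` with `S = V⁻¹`, written out. -/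
lemma rankOne_inv_mulVec (hV : V.PosDef) {r : ℝ} (hr : 0 ≤ r) (a u : Fin d → ℝ) :
    V⁻¹ *ᵥ u = (V + r • Matrix.vecMulVec a a)⁻¹ *ᵥ u +
      (r * (a ⬝ᵥ V⁻¹ *ᵥ u)) • ((V + r • Matrix.vecMulVec a a)⁻¹ *ᵥ a) := by
  conv_lhs => rw [← inv_mulVec_mulVec (posDef_add_smul_vecMulVec hV hr a) (V⁻¹ *ᵥ u)]
  rw [Matrix.add_mulVec, mulVec_inv_mulVec hV, Matrix.mulVec_add, Matrix.smul_mulVec,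
    Matrix.vecMulVec_mulVec, op_smul_eq_smul, smul_smul, Matrix.mulVec_smul]

/-- A rank-one update of the precision decreases the covariance: the difference of the quadratic
forms is `r (1 + r aᵀ S a) (uᵀ S' a)²`, with `S` and `S'` the covariances before and after. -/
lemma rankOne_inv_quadForm_le (hV : V.PosDef) {r : ℝ} (hr : 0 ≤ r) (a u : Fin d → ℝ) :
    u ⬝ᵥ (V + r • Matrix.vecMulVec a a)⁻¹ *ᵥ u ≤ u ⬝ᵥ V⁻¹ *ᵥ u := by
  have hS := hV.inv
  have h1 := congrArg (u ⬝ᵥ ·) (rankOne_inv_mulVec hV hr a u)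
  have h2 := congrArg (u ⬝ᵥ ·) (rankOne_inv_mulVec hV hr a a)
  simp only [dotProduct_add, dotProduct_smul, smul_eq_mul] at h1 h2
  have h3 := dotProduct_mulVec_comm hS.1 a u
  have h4 : 0 ≤ a ⬝ᵥ V⁻¹ *ᵥ a := by simpa using hS.posSemidef.dotProduct_mulVec_nonneg a
  rw [h3, h2] at h1
  have : 0 ≤ (u ⬝ᵥ (V + r • Matrix.vecMulVec a a)⁻¹ *ᵥ a) ^ 2 *
      (r * (1 + r * (a ⬝ᵥ V⁻¹ *ᵥ a))) := by positivity
  nlinarith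

end RankOne

/-! ### Conditioning a Gaussian on a noisy linear observation -/

section OneStep

variable {d : ℕ} {V : Matrix (Fin d) (Fin d) ℝ}

lemma inner_eq_dotProduct (x y : Vec d) : inner ℝ x y = x.ofLp ⬝ᵥ y.ofLp := by
  rw [EuclideanSpace.inner_eq_star_dotProduct, dotProduct_comm]
  simp

/-- Bayes' rule for one reward: if `x ∼ N(V⁻¹ b, V⁻¹)` and `y = ⟪a, x⟫ + e` with independent noise
`e ∼ N(0, σ²)`, then the pair `(y, x)` has the law that arises when `y` is drawn first and `x` is
then drawn from the Gaussian with precision `V + σ⁻² a aᵀ` and information vector `b + σ⁻² y a`.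
Both laws have the same characteristic function. -/
lemma gaussian_linear_observation (hV : V.PosDef) {σ : ℝ} (hσ : 0 < σ) (a b : Vec d) :
    ((multivariateGaussian (WithLp.toLp 2 (V⁻¹ *ᵥ b.ofLp)) V⁻¹).prod
        (gaussianReal 0 (σ ^ 2).toNNReal)).map
      (fun p : Vec d × ℝ => (inner ℝ a p.1 + p.2, p.1)) =
    (((multivariateGaussian (WithLp.toLp 2 (V⁻¹ *ᵥ b.ofLp)) V⁻¹).prod
        (gaussianReal 0 (σ ^ 2).toNNReal)).prod
      (multivariateGaussian (0 : Vec d)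
        (V + (σ ^ 2)⁻¹ • Matrix.vecMulVec a.ofLp a.ofLp)⁻¹)).map
      (fun q : (Vec d × ℝ) × Vec d => (inner ℝ a q.1.1 + q.1.2,
        WithLp.toLp 2 ((V + (σ ^ 2)⁻¹ • Matrix.vecMulVec a.ofLp a.ofLp)⁻¹ *ᵥ
          (b.ofLp + (σ ^ 2)⁻¹ • (inner ℝ a q.1.1 + q.1.2) • a.ofLp)) + q.2)) := by
  have hr : 0 ≤ (σ ^ 2)⁻¹ := by positivity
  set S' := (V + (σ ^ 2)⁻¹ • Matrix.vecMulVec a.ofLp a.ofLp)⁻¹ with hS'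
  have hS'p : S'.PosDef := (posDef_add_smul_vecMulVec hV hr a.ofLp).inv
  set m : Vec d := WithLp.toLp 2 (V⁻¹ *ᵥ b.ofLp) with hm
  set c0 : Vec d := WithLp.toLp 2 (S' *ᵥ b.ofLp) with hc0
  set k : Vec d := WithLp.toLp 2 ((σ ^ 2)⁻¹ • S' *ᵥ a.ofLp) with hk
  have hmean : ∀ y : ℝ, (WithLp.toLp 2 (S' *ᵥ (b.ofLp + (σ ^ 2)⁻¹ • y • a.ofLp)) : Vec d) =
      c0 + y • k := by
    intro y
    rw [hc0, hk, Matrix.mulVec_add, Matrix.mulVec_smul, Matrix.mulVec_smul, smul_comm]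
    rfl
  simp_rw [hmean]
  apply Measure.ext_of_charFunDual
  ext L
  obtain ⟨s, u, hL⟩ : ∃ (s : ℝ) (u : Vec d), ∀ y x, L (y, x) = s * y + inner ℝ u x := by
    refine ⟨L (1, 0), (InnerProductSpace.toDual ℝ (Vec d)).symm
      (L.comp (ContinuousLinearMap.inr ℝ ℝ (Vec d))), fun y x => ?_⟩
    have : ((y, x) : ℝ × Vec d) = y • ((1, 0) : ℝ × Vec d) + (0, x) := by ext <;> simp
    rw [this, map_add, map_smul, InnerProductSpace.toDual_symm_apply]
    simp [mul_comm]
  rw [charFunDual_apply, charFunDual_apply, integral_map (by fun_prop) (by fun_prop),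
    integral_map (by fun_prop) (by fun_prop)]
  simp_rw [hL]
  -- `w` is the frequency seen by `y` once the new mean, which is affine in `y`, is absorbed
  set w : ℝ := s + inner ℝ u k with hw
  have e1 : ∀ p : Vec d × ℝ, Complex.exp (((s * (inner ℝ a p.1 + p.2) + inner ℝ u p.1 : ℝ) : ℂ)
      * Complex.I) = Complex.exp ((inner ℝ p.1 (s • a + u) : ℝ) * Complex.I) *
        Complex.exp (s * p.2 * Complex.I) := by
    intro p
    rw [← Complex.exp_add, inner_add_right, inner_smul_right, real_inner_comm a,
      real_inner_comm u]
    congr 1; push_cast; ring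
  have e2 : ∀ q : (Vec d × ℝ) × Vec d, Complex.exp (((s * (inner ℝ a q.1.1 + q.1.2) +
      inner ℝ u (c0 + (inner ℝ a q.1.1 + q.1.2) • k + q.2) : ℝ) : ℂ)
      * Complex.I) = (Complex.exp ((inner ℝ q.1.1 (w • a) : ℝ) * Complex.I) *
        Complex.exp (w * q.1.2 * Complex.I)) * (Complex.exp ((inner ℝ u c0 : ℝ) * Complex.I) *
        Complex.exp ((inner ℝ q.2 u : ℝ) * Complex.I)) := by
    intro q
    rw [← Complex.exp_add, ← Complex.exp_add, ← Complex.exp_add, inner_add_right, inner_add_right,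
      inner_smul_right, inner_smul_right, real_inner_comm a, real_inner_comm u q.2, hw]
    congr 1; push_cast; ring
  simp_rw [e1, e2]
  rw [integral_prod_mul (fun x : Vec d => Complex.exp ((inner ℝ x (s • a + u) : ℝ) * Complex.I))
      (fun e : ℝ => Complex.exp (s * e * Complex.I)),
    integral_prod_mul (fun p : Vec d × ℝ => Complex.exp ((inner ℝ p.1 (w • a) : ℝ) * Complex.I) *
        Complex.exp (w * p.2 * Complex.I))
      (fun z : Vec d => Complex.exp ((inner ℝ u c0 : ℝ) * Complex.I) *
        Complex.exp ((inner ℝ z u : ℝ) * Complex.I)),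
    integral_prod_mul (fun x : Vec d => Complex.exp ((inner ℝ x (w • a) : ℝ) * Complex.I))
      (fun e : ℝ => Complex.exp (w * e * Complex.I)), integral_const_mul,
    ← charFun_apply, ← charFun_apply, ← charFun_apply, ← charFun_apply_real, ← charFun_apply_real,
    charFun_multivariateGaussian hV.inv.posSemidef, charFun_multivariateGaussian hV.inv.posSemidef,
    charFun_multivariateGaussian hS'p.posSemidef, charFun_gaussianReal, charFun_gaussianReal,
    ← Complex.exp_add, ← Complex.exp_add, ← Complex.exp_add, ← Complex.exp_add]
  have h1 := congrArg (u.ofLp ⬝ᵥ ·) (rankOne_inv_mulVec hV hr a.ofLp b.ofLp)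
  have h2 := congrArg (u.ofLp ⬝ᵥ ·) (rankOne_inv_mulVec hV hr a.ofLp a.ofLp)
  have h3 := congrArg (u.ofLp ⬝ᵥ ·) (rankOne_inv_mulVec hV hr a.ofLp u.ofLp)
  have h4 := dotProduct_mulVec_comm hV.inv.1 a.ofLp u.ofLp
  simp only [dotProduct_add, dotProduct_smul, smul_eq_mul, ← hS'] at h1 h2 h3
  simp only [inner_eq_dotProduct, hw, hm, hc0, hk, WithLp.ofLp_add, WithLp.ofLp_smul,
    dotProduct_add, add_dotProduct,
    dotProduct_smul, smul_dotProduct, smul_eq_mul, Matrix.mulVec_add, Matrix.mulVec_smul,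
    WithLp.ofLp_zero, dotProduct_zero] at *
  have hσ2 : ((σ ^ 2).toNNReal : ℝ) = σ ^ 2 := Real.coe_toNNReal _ (by positivity)
  rw [h4] at *
  rw [hσ2]
  generalize a.ofLp ⬝ᵥ V⁻¹ *ᵥ b.ofLp = p at *
  generalize u.ofLp ⬝ᵥ V⁻¹ *ᵥ b.ofLp = q at *
  generalize a.ofLp ⬝ᵥ V⁻¹ *ᵥ a.ofLp = g at *
  generalize u.ofLp ⬝ᵥ V⁻¹ *ᵥ a.ofLp = f at *
  generalize u.ofLp ⬝ᵥ V⁻¹ *ᵥ u.ofLp = e at *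
  generalize u.ofLp ⬝ᵥ S' *ᵥ a.ofLp = k' at *
  generalize u.ofLp ⬝ᵥ S' *ᵥ u.ofLp = v at *
  generalize u.ofLp ⬝ᵥ S' *ᵥ b.ofLp = c at *
  -- `κ` is the component along `u` of the gain, the slope of the new mean in `y`
  obtain ⟨κ, rfl⟩ : ∃ κ, k' = σ ^ 2 * κ := ⟨(σ ^ 2)⁻¹ * k', by field_simp⟩
  have h2' : f = κ * (σ ^ 2 + g) := by rw [h2]; field_simp
  have h1' : q = c + κ * p := by rw [h1]; field_simp
  have h3' : e = v + κ * f := by rw [h3]; field_simp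
  have hκ : (σ ^ 2)⁻¹ * (σ ^ 2 * κ) = κ := by field_simp
  rw [hκ, h3', h1', h2']
  congr 1
  push_cast
  ring

end OneStep

/-! ### The posterior as a kernel of the history -/

section Posterior

variable {d t : ℕ} {Sig0 : Matrix (Fin d) (Fin d) ℝ}

/-- The posterior precision `Σ₀⁻¹ + σ⁻² ∑ ℓ, A_ℓ A_ℓᵀ`, whose inverse is `postCov`. -/
def postPrec (Sig0 : Matrix (Fin d) (Fin d) ℝ) (σ : ℝ) (h : Hist d t) :
    Matrix (Fin d) (Fin d) ℝ :=
  Sig0⁻¹ + (σ ^ 2)⁻¹ • ∑ l, Matrix.vecMulVec (h l).1.ofLp (h l).1.ofLp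

/-- The information vector `Σ₀⁻¹ θ₀ + σ⁻² ∑ ℓ, Y_ℓ A_ℓ`: posterior precision times posterior
mean. -/
def postInfo (theta0 : Vec d) (Sig0 : Matrix (Fin d) (Fin d) ℝ) (σ : ℝ) (h : Hist d t) : Vec d :=
  WithLp.toLp 2 (Sig0⁻¹ *ᵥ theta0.ofLp + (σ ^ 2)⁻¹ • ∑ l, (h l).2 • (h l).1.ofLp)

/-- The history `h` extended by a round with action `a` and reward `y`. -/
def Hist.snoc (h : Hist d t) (a : Vec d) (y : ℝ) : Hist d (t + 1) :=
  Fin.snoc (α := fun _ => Vec d × ℝ) h (a, y)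

lemma postCov_eq (σ : ℝ) (h : Hist d t) : postCov Sig0 σ h = (postPrec Sig0 σ h)⁻¹ := rfl

lemma postMean_eq (theta0 : Vec d) (σ : ℝ) (h : Hist d t) :
    postMean theta0 Sig0 σ h =
      WithLp.toLp 2 ((postPrec Sig0 σ h)⁻¹ *ᵥ (postInfo theta0 Sig0 σ h).ofLp) := rfl

lemma postPrec_snoc (σ : ℝ) (h : Hist d t) (a : Vec d) (y : ℝ) :
    postPrec Sig0 σ (h.snoc a y) =
      postPrec Sig0 σ h + (σ ^ 2)⁻¹ • Matrix.vecMulVec a.ofLp a.ofLp := by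
  simp [postPrec, Hist.snoc, Fin.sum_univ_castSucc, add_assoc]

lemma postInfo_snoc (theta0 : Vec d) (σ : ℝ) (h : Hist d t) (a : Vec d) (y : ℝ) :
    (postInfo theta0 Sig0 σ (h.snoc a y)).ofLp =
      (postInfo theta0 Sig0 σ h).ofLp + (σ ^ 2)⁻¹ • y • a.ofLp := by
  simp [postInfo, Hist.snoc, Fin.sum_univ_castSucc, add_assoc]

lemma postPrec_posDef (hSig0 : Sig0.PosDef) (σ : ℝ) (h : Hist d t) :
    (postPrec Sig0 σ h).PosDef := by
  refine hSig0.inv.add_posSemidef (Matrix.PosSemidef.smul ?_ (by positivity))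
  refine Matrix.posSemidef_sum _ fun l _ => ?_
  simpa using Matrix.posSemidef_vecMulVec_self_star (h l).1.ofLp

lemma postCov_posDef (hSig0 : Sig0.PosDef) (σ : ℝ) (h : Hist d t) :
    (postCov Sig0 σ h).PosDef :=
  (postPrec_posDef hSig0 σ h).inv

lemma postPrec_zero (σ : ℝ) (h : Hist d 0) : postPrec Sig0 σ h = Sig0⁻¹ := by
  simp [postPrec]

lemma inv_inv_of_posDef (hSig0 : Sig0.PosDef) : Sig0⁻¹⁻¹ = Sig0 :=
  Matrix.nonsing_inv_nonsing_inv _ ((Matrix.isUnit_iff_isUnit_det _).1 hSig0.isUnit)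

lemma postCov_zero (hSig0 : Sig0.PosDef) (σ : ℝ) (h : Hist d 0) : postCov Sig0 σ h = Sig0 := by
  rw [postCov_eq, postPrec_zero, inv_inv_of_posDef hSig0]

lemma Hist.exists_snoc (h : Hist d (t + 1)) : ∃ h' : Hist d t, ∃ a y, h = h'.snoc a y :=
  ⟨fun l => h l.castSucc, (h (Fin.last t)).1, (h (Fin.last t)).2, by
    funext l
    refine Fin.lastCases ?_ (fun l => ?_) l <;> simp [Hist.snoc]⟩

lemma history_succ {Ω : Type*} (A : ℕ → Ω → Vec d) (Y : ℕ → Ω → ℝ) (t : ℕ) (ω : Ω) :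
    history A Y (t + 1) ω = (history A Y t ω).snoc (A t ω) (Y t ω) := by
  funext l
  refine Fin.lastCases ?_ (fun l => ?_) l <;> simp [history, Hist.snoc]

/-- Observations only shrink the posterior covariance below the prior covariance. -/
lemma wnorm_postCov_le (hSig0 : Sig0.PosDef) (σ : ℝ) (h : Hist d t) (a : Vec d) :
    wnorm (postCov Sig0 σ h) a ≤ wnorm Sig0 a := by
  refine Real.sqrt_le_sqrt ?_
  induction t with
  | zero => rw [postCov_zero hSig0]
  | succ t ih =>
    obtain ⟨h', b, y, rfl⟩ := h.exists_snoc
    refine le_trans ?_ (ih h')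
    rw [postCov_eq, postCov_eq, postPrec_snoc]
    exact rankOne_inv_quadForm_le (postPrec_posDef hSig0 σ h') (by positivity) _ _

lemma continuous_postPrec (Sig0 : Matrix (Fin d) (Fin d) ℝ) (σ : ℝ) :
    Continuous (postPrec Sig0 σ : Hist d t → _) := by
  unfold postPrec
  have hc : Continuous fun h : Hist d t =>
      ∑ l, Matrix.vecMulVec (h l).1.ofLp (h l).1.ofLp :=
    continuous_finsetSum _ fun l _ => Continuous.matrix_vecMulVec (by fun_prop) (by fun_prop)
  exact continuous_const.add (hc.const_smul ((σ ^ 2)⁻¹))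

lemma continuous_postCov (hSig0 : Sig0.PosDef) (σ : ℝ) :
    Continuous (postCov Sig0 σ : Hist d t → _) := by
  have h1 := continuous_postPrec (t := t) Sig0 σ
  have : (postCov Sig0 σ : Hist d t → _) =
      fun h => (postPrec Sig0 σ h).det⁻¹ • (postPrec Sig0 σ h).adjugate := by
    funext h
    rw [postCov_eq, Matrix.inv_def, Ring.inverse_eq_inv']
  rw [this]
  exact (h1.matrix_det.inv₀ fun h => (postPrec_posDef hSig0 σ h).det_pos.ne').smul
    h1.matrix_adjugate

lemma continuous_postMean (theta0 : Vec d) (hSig0 : Sig0.PosDef) (σ : ℝ) :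
    Continuous (postMean theta0 Sig0 σ : Hist d t → _) := by
  unfold postMean
  refine (PiLp.continuous_toLp 2 _).comp ?_
  exact (continuous_postCov hSig0 σ).matrix_mulVec (by fun_prop)

/-- The square root of the posterior covariance. -/
def postSqrt (Sig0 : Matrix (Fin d) (Fin d) ℝ) (σ : ℝ) (h : Hist d t) :
    Matrix (Fin d) (Fin d) ℝ :=
  open scoped MatrixOrder in CFC.sqrt (postCov Sig0 σ h)

open scoped MatrixOrder Matrix.Norms.L2Operator in
lemma continuous_postSqrt (hSig0 : Sig0.PosDef) (σ : ℝ) :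
    Continuous (postSqrt Sig0 σ : Hist d t → _) := by
  have h1 : ContinuousOn CFC.sqrt {a : Matrix (Fin d) (Fin d) ℝ | 0 ≤ a} := CFC.continuousOn_sqrt
  exact h1.comp_continuous (continuous_postCov hSig0 σ)
    fun h => (postCov_posDef hSig0 σ h).posSemidef.nonneg

open scoped MatrixOrder in
lemma postSqrt_mul_self (hSig0 : Sig0.PosDef) (σ : ℝ) (h : Hist d t) :
    postSqrt Sig0 σ h * postSqrt Sig0 σ h = postCov Sig0 σ h :=
  CFC.sqrt_mul_sqrt_self _ (postCov_posDef hSig0 σ h).posSemidef.nonneg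

open scoped MatrixOrder in
lemma postSqrt_isHermitian (Sig0 : Matrix (Fin d) (Fin d) ℝ) (σ : ℝ) (h : Hist d t) :
    (postSqrt Sig0 σ h).IsHermitian :=
  (CFC.sqrt_nonneg (postCov Sig0 σ h)).isSelfAdjoint

/-- A posterior sample as a function of a standard Gaussian vector `z`. -/
def postSample (theta0 : Vec d) (Sig0 : Matrix (Fin d) (Fin d) ℝ) (σ : ℝ) (h : Hist d t)
    (z : Vec d) : Vec d :=
  postMean theta0 Sig0 σ h + WithLp.toLp 2 (postSqrt Sig0 σ h *ᵥ z.ofLp)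

lemma continuous_postSample (theta0 : Vec d) (hSig0 : Sig0.PosDef) (σ : ℝ) :
    Continuous (fun p : Hist d t × Vec d => postSample theta0 Sig0 σ p.1 p.2) := by
  unfold postSample
  refine ((continuous_postMean theta0 hSig0 σ).comp continuous_fst).add
    ((PiLp.continuous_toLp 2 _).comp ?_)
  exact ((continuous_postSqrt hSig0 σ).comp continuous_fst).matrix_mulVec (by fun_prop)

lemma measurable_postSample_right (theta0 : Vec d) (Sig0 : Matrix (Fin d) (Fin d) ℝ) (σ : ℝ)
    (h : Hist d t) : Measurable (postSample theta0 Sig0 σ h) := by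
  unfold postSample
  exact (continuous_const.add ((PiLp.continuous_toLp 2 _).comp
    (continuous_const.matrix_mulVec (by fun_prop)))).measurable

lemma posterior_eq_map (theta0 : Vec d) (Sig0 : Matrix (Fin d) (Fin d) ℝ) (σ : ℝ) (h : Hist d t) :
    posterior theta0 Sig0 σ h =
      (stdGaussian (Vec d)).map (postSample theta0 Sig0 σ h) := rfl

lemma multivariateGaussian_eq_map_add (m : Vec d) (S : Matrix (Fin d) (Fin d) ℝ) :
    multivariateGaussian m S = (multivariateGaussian 0 S).map (fun z => m + z) := by
  rw [multivariateGaussian, multivariateGaussian, Measure.map_map (by fun_prop) (by fun_prop)]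
  congr 1
  funext x
  simp

/-- The posterior, as a Markov kernel of the history. -/
def postKernel (t : ℕ) (theta0 : Vec d) (hSig0 : Sig0.PosDef) (σ : ℝ) :
    Kernel (Hist d t) (Vec d) where
  toFun := posterior theta0 Sig0 σ
  measurable' := by
    refine Measure.measurable_of_measurable_coe _ fun s hs => ?_
    have hc := (continuous_postSample (t := t) theta0 hSig0 σ).measurable
    have : (fun h : Hist d t => posterior theta0 Sig0 σ h s) = fun h =>
        stdGaussian (Vec d) (Prod.mk h ⁻¹'
          ((fun p : Hist d t × Vec d => postSample theta0 Sig0 σ p.1 p.2) ⁻¹' s)) := by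
      funext h
      rw [posterior_eq_map, Measure.map_apply (measurable_postSample_right theta0 Sig0 σ h) hs]
      rfl
    rw [this]
    exact measurable_measure_prodMk_left (hc hs)

lemma postKernel_apply (theta0 : Vec d) (hSig0 : Sig0.PosDef) (σ : ℝ) (h : Hist d t) :
    postKernel t theta0 hSig0 σ h = posterior theta0 Sig0 σ h := rfl

instance (theta0 : Vec d) (σ : ℝ) (h : Hist d t) :
    IsProbabilityMeasure (posterior theta0 Sig0 σ h) := by
  unfold posterior; infer_instance

instance (theta0 : Vec d) (hSig0 : Sig0.PosDef) (σ : ℝ) :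
    IsMarkovKernel (postKernel t theta0 hSig0 σ) :=
  ⟨fun h => by rw [postKernel_apply]; infer_instance⟩

lemma measurable_snoc : Measurable
    (fun p : Hist d t × Vec d × ℝ => p.1.snoc p.2.1 p.2.2) := by
  refine measurable_pi_iff.2 fun l => ?_
  refine Fin.lastCases ?_ (fun l => ?_) l
  · simp only [Hist.snoc, Fin.snoc_last]; fun_prop
  · simp only [Hist.snoc, Fin.snoc_castSucc]; fun_prop

/-- Bayes' rule for one reward, in terms of the posteriors before and after the round: the pair of
new history and parameter keeps its law when the parameter is resampled from the new posterior. -/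
lemma lintegral_posterior_snoc (theta0 : Vec d) (hSig0 : Sig0.PosDef) {σ : ℝ} (hσ : 0 < σ)
    (h : Hist d t) (a : Vec d) {f : Hist d (t + 1) × Vec d → ENNReal} (hf : Measurable f) :
    ∫⁻ x, ∫⁻ e, f (h.snoc a (inner ℝ a x + e), x) ∂(gaussianReal 0 (σ ^ 2).toNNReal)
        ∂(posterior theta0 Sig0 σ h) =
      ∫⁻ x, ∫⁻ e, ∫⁻ x', f (h.snoc a (inner ℝ a x + e), x')
        ∂(posterior theta0 Sig0 σ (h.snoc a (inner ℝ a x + e)))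
        ∂(gaussianReal 0 (σ ^ 2).toNNReal) ∂(posterior theta0 Sig0 σ h) := by
  have key := gaussian_linear_observation (postPrec_posDef hSig0 σ h) hσ a
    (postInfo theta0 Sig0 σ h)
  rw [← postMean_eq, ← postCov_eq, ← posterior] at key
  have hsn : Measurable fun p : ℝ × Vec d => (h.snoc a p.1, p.2) :=
    (measurable_snoc.comp (by fun_prop : Measurable fun p : ℝ × Vec d => (h, a, p.1))).prodMk
      measurable_snd
  have hg : Measurable fun p : ℝ × Vec d => f (h.snoc a p.1, p.2) := hf.comp hsn
  have hm1 : Measurable fun p : Vec d × ℝ => (inner ℝ a p.1 + p.2, p.1) := by fun_prop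
  have key2 := congrArg (fun ν => ∫⁻ p, f (h.snoc a p.1, p.2) ∂ν) key
  simp only at key2
  have hm2 : Measurable fun q : (Vec d × ℝ) × Vec d => (inner ℝ a q.1.1 + q.1.2,
        WithLp.toLp 2 ((postPrec Sig0 σ h + (σ ^ 2)⁻¹ • Matrix.vecMulVec a.ofLp a.ofLp)⁻¹ *ᵥ
          ((postInfo theta0 Sig0 σ h).ofLp +
            (σ ^ 2)⁻¹ • (inner ℝ a q.1.1 + q.1.2) • a.ofLp)) + q.2) := by
    refine Continuous.measurable (Continuous.prodMk (by fun_prop) (Continuous.add ?_ (by fun_prop)))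
    exact (PiLp.continuous_toLp 2 _).comp (continuous_const.matrix_mulVec (by fun_prop))
  have hg1 := hg.comp hm1
  have hg2 := hg.comp hm2
  simp only [Function.comp_def] at hg1 hg2
  rw [lintegral_map hg hm1, lintegral_map hg hm2] at key2
  simp only at key2
  rw [lintegral_prod _ hg1.aemeasurable, lintegral_prod _ hg2.aemeasurable, lintegral_prod] at key2
  · rw [key2]
    refine lintegral_congr fun x => lintegral_congr fun e => ?_
    symm
    have hfm : Measurable fun x' => f (h.snoc a (inner ℝ a x + e), x') :=
      hf.comp measurable_prodMk_left
    rw [posterior, multivariateGaussian_eq_map_add (postMean _ _ _ _),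
      lintegral_map hfm (by fun_prop), postMean_eq,
      postInfo_snoc, postCov_eq, postPrec_snoc]
  · exact (Measurable.lintegral_prod_right' hg2).aemeasurable

end Posterior

/-! ### The conditional law of the parameter given the history -/

section CondDistrib

variable {Ω 𝓧 𝓨 : Type*} [MeasurableSpace Ω] [MeasurableSpace 𝓧] [MeasurableSpace 𝓨]
  {P : Measure Ω} [IsProbabilityMeasure P] {X : Ω → 𝓧} {Y : Ω → 𝓨} {κ : Kernel 𝓧 𝓨}
  [IsMarkovKernel κ]

lemma _root_.ProbabilityTheory.HasCondDistrib.lintegral_eq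
    (h : HasCondDistrib Y X κ P) (hX : Measurable X)
    {f : 𝓧 × 𝓨 → ENNReal} (hf : Measurable f) :
    ∫⁻ ω, f (X ω, Y ω) ∂P = ∫⁻ ω, ∫⁻ y, f (X ω, y) ∂(κ (X ω)) ∂P := by
  rw [← lintegral_map' (f := f) hf.aemeasurable h.aemeasurable, h.map_eq,
    Measure.lintegral_compProd hf, lintegral_map hf.lintegral_kernel_prod_right' hX]

lemma _root_.ProbabilityTheory.HasCondDistrib.of_lintegral_eq
    (hX : Measurable X) (hY : Measurable Y)
    (h : ∀ f : 𝓧 × 𝓨 → ENNReal, Measurable f →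
      ∫⁻ ω, f (X ω, Y ω) ∂P = ∫⁻ ω, ∫⁻ y, f (X ω, y) ∂(κ (X ω)) ∂P) :
    HasCondDistrib Y X κ P where
  aemeasurable := (hX.prodMk hY).aemeasurable
  map_eq := by
    refine Measure.ext_of_lintegral _ fun f hf => ?_
    rw [lintegral_map hf (hX.prodMk hY), Measure.lintegral_compProd hf,
      lintegral_map hf.lintegral_kernel_prod_right' hX, h f hf]

lemma _root_.ProbabilityTheory.HasCondDistrib.integral_eq
    (h : HasCondDistrib Y X κ P) (hX : Measurable X)
    {f : 𝓧 × 𝓨 → ℝ} (hf : Measurable f) (hint : Integrable (fun ω => f (X ω, Y ω)) P) :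
    ∫ ω, f (X ω, Y ω) ∂P = ∫ ω, ∫ y, f (X ω, y) ∂(κ (X ω)) ∂P := by
  have h1 : Integrable f (P.map X ⊗ₘ κ) := by
    rw [← h.map_eq, integrable_map_measure hf.aestronglyMeasurable h.aemeasurable]
    exact hint
  rw [← integral_map (f := f) h.aemeasurable hf.aestronglyMeasurable, h.map_eq,
    Measure.integral_compProd h1,
    integral_map hX.aemeasurable
      hf.stronglyMeasurable.integral_kernel_prod_right'.aestronglyMeasurable]

lemma _root_.ProbabilityTheory.HasCondDistrib.integrable_integral
    (h : HasCondDistrib Y X κ P) (hX : Measurable X)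
    {f : 𝓧 × 𝓨 → ℝ} (hf : Measurable f) (hint : Integrable (fun ω => f (X ω, Y ω)) P) :
    Integrable (fun ω => ∫ y, f (X ω, y) ∂(κ (X ω))) P := by
  have h1 : Integrable f (P.map X ⊗ₘ κ) := by
    rw [← h.map_eq, integrable_map_measure hf.aestronglyMeasurable h.aemeasurable]
    exact hint
  have h2 : Integrable (fun x => ∫ y, f (x, y) ∂(κ x)) (P.map X) := h1.integral_compProd
  exact (integrable_map_measure h2.1 hX.aemeasurable).1 h2

end CondDistrib

section Bandit

variable {Ω : Type*} [MeasurableSpace Ω] {μ : Measure Ω}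
  {d n : ℕ} {theta0 : Vec d} {Sig0 : Matrix (Fin d) (Fin d) ℝ} {σ : ℝ} {F : ℕ → Set (Vec d)}
  {θs : Ω → Vec d} {A : ℕ → Ω → Vec d} {Y ε : ℕ → Ω → ℝ}

lemma IsLinearBandit.measurable_history (hb : IsLinearBandit μ n theta0 Sig0 σ F θs A Y ε)
    {t : ℕ} (ht : t ≤ n) : Measurable (history A Y t) := by
  refine measurable_pi_iff.2 fun l => ?_
  have hl : (l : ℕ) < n := l.2.trans_le ht
  have hA := hb.measurable_action l hl
  have hY : Y l = fun ω => inner ℝ (A l ω) (θs ω) + ε l ω := funext (hb.reward l hl)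
  refine hA.prodMk ?_
  rw [hY]
  exact (hA.inner hb.measurable_param).add (hb.measurable_noise l hl)

/-- The agent decides from the history alone: the conditional law of every action, given the
parameter and the history, is a kernel of the history. -/
def IsHistoryBased (μ : Measure Ω) (n : ℕ) (θs : Ω → Vec d) (A : ℕ → Ω → Vec d)
    (Y : ℕ → Ω → ℝ) : Prop :=
  ∀ t < n, ∃ κ : Kernel (Hist d t) (Vec d), IsMarkovKernel κ ∧
    HasCondDistrib (A t) (fun ω => (θs ω, history A Y t ω)) (Kernel.prodMkLeft (Vec d) κ) μ

lemma IsLinUCB.isHistoryBased {α : ℝ} (h : IsLinUCB μ n theta0 Sig0 σ α F θs A Y) :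
    IsHistoryBased μ n θs A Y :=
  fun t ht => (h t ht).1

variable [IsProbabilityMeasure μ]

lemma IsLinTS.isHistoryBased (h : IsLinTS μ n theta0 Sig0 σ F θs A Y) :
    IsHistoryBased μ n θs A Y := by
  obtain ⟨θt, h⟩ := h
  intro t ht
  obtain ⟨-, ⟨κ, hκ, -, hd⟩, -⟩ := h t ht
  refine ⟨κ.snd, inferInstance, ?_⟩
  have := hd.snd
  rwa [Kernel.snd_prodMkLeft] at this

/-- If the posterior is correct before round `t`, then in that round history, action, parameter
and noise are drawn one after the other: the action from a kernel of the history, the parameter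
from the posterior and the noise from its own law. -/
lemma IsLinearBandit.lintegral_round (hb : IsLinearBandit μ n theta0 Sig0 σ F θs A Y ε)
    (hSig0 : Sig0.PosDef) {t : ℕ} (ht : t < n) {κ : Kernel (Hist d t) (Vec d)}
    [IsMarkovKernel κ]
    (hκ : HasCondDistrib (A t) (fun ω => (θs ω, history A Y t ω)) (Kernel.prodMkLeft (Vec d) κ) μ)
    (hpost : HasCondDistrib θs (history A Y t) (postKernel t theta0 hSig0 σ) μ)
    {G : ((Hist d t × Vec d) × Vec d) × ℝ → ENNReal} (hG : Measurable G) :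
    ∫⁻ ω, G (((history A Y t ω, A t ω), θs ω), ε t ω) ∂μ =
      ∫⁻ ω, ∫⁻ a, ∫⁻ x, ∫⁻ e, G (((history A Y t ω, a), x), e)
        ∂(gaussianReal 0 (σ ^ 2).toNNReal) ∂(posterior theta0 Sig0 σ (history A Y t ω))
        ∂(κ (history A Y t ω)) ∂μ := by
  have hθ := hb.measurable_param
  have hA := hb.measurable_action t ht
  have hε := hb.measurable_noise t ht
  have hH := hb.measurable_history ht.le
  -- integrate out the noise
  have hG1 : Measurable fun p : (Hist d t × Vec d) × Vec d =>
      ∫⁻ e, G (p, e) ∂(gaussianReal 0 (σ ^ 2).toNNReal) := hG.lintegral_prod_right'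
  have e1 : ∫⁻ ω, G (((history A Y t ω, A t ω), θs ω), ε t ω) ∂μ =
      ∫⁻ ω, ∫⁻ e, G (((history A Y t ω, A t ω), θs ω), e)
        ∂(gaussianReal 0 (σ ^ 2).toNNReal) ∂μ := by
    have hind : IndepFun (fun ω => ((history A Y t ω, A t ω), θs ω)) (ε t) μ :=
      ((hb.noise_indep t ht).comp measurable_id
        (by fun_prop : Measurable fun p : Vec d × Hist d t × Vec d => ((p.2.1, p.2.2), p.1))).symm
    have hm : Measurable fun ω => ((history A Y t ω, A t ω), θs ω) := by fun_prop
    have hmap := (indepFun_iff_map_prod_eq_prod_map_map hm.aemeasurable hε.aemeasurable).1 hind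
    rw [hb.noise_law t ht] at hmap
    rw [← lintegral_map (f := G) hG (hm.prodMk hε), hmap, lintegral_prod _ hG.aemeasurable,
      lintegral_map hG1 hm]
  -- integrate out the action
  have hG2 : Measurable fun p : (Vec d × Hist d t) × Vec d =>
      ∫⁻ e, G (((p.1.2, p.2), p.1.1), e) ∂(gaussianReal 0 (σ ^ 2).toNNReal) :=
    hG1.comp (by fun_prop :
      Measurable fun p : (Vec d × Hist d t) × Vec d => ((p.1.2, p.2), p.1.1))
  have e2 := HasCondDistrib.lintegral_eq hκ (hθ.prodMk hH) hG2
  -- integrate out the parameter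
  have hG3 : Measurable fun p : Hist d t × Vec d => ∫⁻ a, ∫⁻ e, G (((p.1, a), p.2), e)
      ∂(gaussianReal 0 (σ ^ 2).toNNReal) ∂(κ p.1) :=
    (Measurable.lintegral_kernel_prod_right' (κ := Kernel.prodMkLeft (Vec d) κ) hG2).comp
      measurable_swap
  have e3 := HasCondDistrib.lintegral_eq hpost hH hG3
  rw [e1]
  refine e2.trans (e3.trans (lintegral_congr fun ω => ?_))
  rw [postKernel_apply]
  refine lintegral_lintegral_swap (μ := posterior theta0 Sig0 σ (history A Y t ω))
    (ν := κ (history A Y t ω)) ?_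
  exact (hG1.comp (by fun_prop : Measurable fun p : Vec d × Vec d =>
    ((history A Y t ω, p.2), p.1))).aemeasurable

/-- The conditional law of the parameter given the history is the posterior. -/
theorem IsLinearBandit.hasCondDistrib_history (hb : IsLinearBandit μ n theta0 Sig0 σ F θs A Y ε)
    (hSig0 : Sig0.PosDef) (hσ : 0 < σ) (hA : IsHistoryBased μ n θs A Y) {t : ℕ} (ht : t ≤ n) :
    HasCondDistrib θs (history A Y t) (postKernel t theta0 hSig0 σ) μ := by
  induction t with
  | zero =>
    refine HasCondDistrib.of_lintegral_eq (hb.measurable_history ht) hb.measurable_param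
      fun f hf => ?_
    have h0 : ∀ ω, history A Y 0 ω = Fin.elim0 := fun ω => Subsingleton.elim _ _
    have hp : posterior theta0 Sig0 σ (Fin.elim0 : Hist d 0) = μ.map θs := by
      rw [hb.prior, posterior, postMean_eq, postCov_zero hSig0, postPrec_zero]
      congr 1
      simp [postInfo, inv_mulVec_mulVec hSig0.inv]
    simp only [h0, postKernel_apply, hp, lintegral_const, measure_univ, mul_one]
    have hf0 : Measurable fun x => f (Fin.elim0, x) := hf.comp measurable_prodMk_left
    rw [lintegral_map hf0 hb.measurable_param]
  | succ t ih =>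
    have htn : t < n := ht
    have hpost := ih htn.le
    obtain ⟨κ, hκm, hκ⟩ := hA t htn
    refine HasCondDistrib.of_lintegral_eq (hb.measurable_history ht) hb.measurable_param
      fun f hf => ?_
    have hsucc : ∀ ω, history A Y (t + 1) ω =
        (history A Y t ω).snoc (A t ω) (inner ℝ (A t ω) (θs ω) + ε t ω) := fun ω => by
      rw [history_succ, hb.reward t htn ω]
    have hsn : Measurable fun p : ((Hist d t × Vec d) × Vec d) × ℝ =>
        p.1.1.1.snoc p.1.1.2 (inner ℝ p.1.1.2 p.1.2 + p.2) :=
      measurable_snoc.comp (by fun_prop :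
        Measurable fun p : ((Hist d t × Vec d) × Vec d) × ℝ =>
          (p.1.1.1, p.1.1.2, inner ℝ p.1.1.2 p.1.2 + p.2))
    have hf' : Measurable fun h : Hist d (t + 1) =>
        ∫⁻ x, f (h, x) ∂(posterior theta0 Sig0 σ h) :=
      hf.lintegral_kernel_prod_right' (κ := postKernel (t + 1) theta0 hSig0 σ)
    have r1 := hb.lintegral_round hSig0 htn hκ hpost
      (G := fun p => f (p.1.1.1.snoc p.1.1.2 (inner ℝ p.1.1.2 p.1.2 + p.2), p.1.2))
      (hf.comp (hsn.prodMk (by fun_prop)))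
    have r2 := hb.lintegral_round hSig0 htn hκ hpost
      (G := fun p => ∫⁻ x, f (p.1.1.1.snoc p.1.1.2 (inner ℝ p.1.1.2 p.1.2 + p.2), x)
        ∂(posterior theta0 Sig0 σ (p.1.1.1.snoc p.1.1.2 (inner ℝ p.1.1.2 p.1.2 + p.2))))
      (hf'.comp hsn)
    simp only [hsucc, postKernel_apply]
    rw [r1, r2]
    exact lintegral_congr fun ω => lintegral_congr fun a =>
      lintegral_posterior_snoc theta0 hSig0 hσ _ a hf

/-- Given the history and the action of the round, the conditional law of the parameter is still
the posterior given the history. -/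
theorem IsLinearBandit.hasCondDistrib_action (hb : IsLinearBandit μ n theta0 Sig0 σ F θs A Y ε)
    (hSig0 : Sig0.PosDef) (hσ : 0 < σ) (hA : IsHistoryBased μ n θs A Y) {t : ℕ} (ht : t < n) :
    HasCondDistrib θs (fun ω => (history A Y t ω, A t ω))
      (Kernel.prodMkRight (Vec d) (postKernel t theta0 hSig0 σ)) μ := by
  have hpost := hb.hasCondDistrib_history hSig0 hσ hA ht.le
  obtain ⟨κ, hκm, hκ⟩ := hA t ht
  refine HasCondDistrib.of_lintegral_eq
    ((hb.measurable_history ht.le).prodMk (hb.measurable_action t ht)) hb.measurable_param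
    fun f hf => ?_
  have hf' : Measurable fun h : Hist d t × Vec d =>
      ∫⁻ x, f (h, x) ∂(posterior theta0 Sig0 σ h.1) :=
    hf.lintegral_kernel_prod_right'
      (κ := Kernel.prodMkRight (Vec d) (postKernel t theta0 hSig0 σ))
  have r1 := hb.lintegral_round hSig0 ht hκ hpost (G := fun p => f p.1) (hf.comp measurable_fst)
  have r2 := hb.lintegral_round hSig0 ht hκ hpost
    (G := fun p => ∫⁻ x, f (p.1.1, x) ∂(posterior theta0 Sig0 σ p.1.1.1))
    (hf'.comp (by fun_prop))
  simp only [Kernel.prodMkRight_apply, postKernel_apply]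
  rw [r1, r2]
  simp

end Bandit

/-! ### Gaussian tails -/

section Tail

/-- `𝔼 (Z - c)₊ ≤ 𝔼 Z 1{Z > c} = φ(c)` for a standard Gaussian `Z` with density `φ`. -/
lemma lintegral_gaussianReal_sub_le {c : ℝ} (hc : 0 ≤ c) :
    ∫⁻ y, ENNReal.ofReal (y - c) ∂(gaussianReal 0 1) ≤
      ENNReal.ofReal ((Real.sqrt (2 * Real.pi))⁻¹ * Real.exp (-c ^ 2 / 2)) := by
  set r : ℝ := (Real.sqrt (2 * Real.pi))⁻¹ with hr
  have hr0 : 0 ≤ r := by positivity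
  have hderiv : ∀ y ∈ Set.Ici c, HasDerivAt (fun y => -(r * Real.exp (-y ^ 2 / 2)))
      (y * (r * Real.exp (-y ^ 2 / 2))) y := by
    intro y _
    have h1 : HasDerivAt (fun y : ℝ => -y ^ 2 / 2) (-y) y := by
      have := ((hasDerivAt_pow 2 y).neg).div_const 2
      exact this.congr_deriv (by push_cast; ring)
    have := (h1.exp.const_mul r).neg
    exact this.congr_deriv (by ring)
  have hpos : ∀ y ∈ Set.Ioi c, 0 ≤ y * (r * Real.exp (-y ^ 2 / 2)) := by
    intro y hy
    have : 0 ≤ y := hc.trans (le_of_lt hy)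
    positivity
  have hlim : Filter.Tendsto (fun y => -(r * Real.exp (-y ^ 2 / 2))) Filter.atTop (nhds 0) := by
    have h1 : Filter.Tendsto (fun y : ℝ => -y ^ 2 / 2) Filter.atTop Filter.atBot := by
      have h2 : Filter.Tendsto (fun y : ℝ => y ^ 2 / 2) Filter.atTop Filter.atTop :=
        (Filter.tendsto_pow_atTop two_ne_zero).atTop_div_const two_pos
      convert Filter.tendsto_neg_atTop_atBot.comp h2 using 1
      funext y
      simp [neg_div]
    simpa using ((Real.tendsto_exp_atBot.comp h1).const_mul r).neg
  have hint := integrableOn_Ioi_deriv_of_nonneg' hderiv hpos hlim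
  have hval := integral_Ioi_of_hasDerivAt_of_nonneg' hderiv hpos hlim
  calc ∫⁻ y, ENNReal.ofReal (y - c) ∂(gaussianReal 0 1)
      = ∫⁻ y, gaussianPDF 0 1 y * ENNReal.ofReal (y - c) := by
        rw [gaussianReal_of_var_ne_zero _ one_ne_zero,
          lintegral_withDensity_eq_lintegral_mul _ (measurable_gaussianPDF 0 1) (by fun_prop)]
        rfl
    _ ≤ ∫⁻ y, (Set.Ioi c).indicator
          (fun y => ENNReal.ofReal (y * (r * Real.exp (-y ^ 2 / 2)))) y := by
        refine lintegral_mono fun y => ?_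
        by_cases hy : c < y
        · rw [Set.indicator_of_mem (Set.mem_Ioi.2 hy), gaussianPDF,
            ← ENNReal.ofReal_mul (gaussianPDFReal_nonneg 0 1 y)]
          refine ENNReal.ofReal_le_ofReal ?_
          rw [gaussianPDFReal]
          simp only [NNReal.coe_one, mul_one, sub_zero]
          rw [mul_comm]
          exact mul_le_mul_of_nonneg_right (by linarith) (by positivity)
        · rw [ENNReal.ofReal_of_nonpos (by linarith : y - c ≤ 0), mul_zero]
          exact zero_le
    _ = ENNReal.ofReal (r * Real.exp (-c ^ 2 / 2)) := by
        rw [lintegral_indicator measurableSet_Ioi, ← ofReal_integral_eq_lintegral_ofReal hint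
          (ae_restrict_of_forall_mem measurableSet_Ioi hpos), hval]
        simp

lemma map_inner_stdGaussian {d : ℕ} (v : Vec d) :
    (stdGaussian (Vec d)).map (fun z => inner ℝ v z) =
      (gaussianReal 0 1).map (fun y => ‖v‖ * y) := by
  refine Measure.ext_of_charFun (funext fun s => ?_)
  rw [charFun_apply_real, charFun_apply_real, integral_map (by fun_prop) (by fun_prop),
    integral_map (by fun_prop) (by fun_prop)]
  have e1 : ∀ z : Vec d, Complex.exp (s * (inner ℝ v z : ℝ) * Complex.I) =
      Complex.exp ((inner ℝ z (s • v) : ℝ) * Complex.I) := by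
    intro z
    rw [inner_smul_right, real_inner_comm]
    push_cast
    rfl
  have e2 : ∀ y : ℝ, Complex.exp (s * ((‖v‖ * y : ℝ) : ℂ) * Complex.I) =
      Complex.exp (((s * ‖v‖ : ℝ) : ℂ) * y * Complex.I) := by
    intro y
    congr 1; push_cast; ring
  simp_rw [e1, e2]
  rw [← charFun_apply, ← charFun_apply_real, charFun_stdGaussian, charFun_gaussianReal,
    norm_smul, ← Complex.ofReal_pow, mul_pow, Real.norm_eq_abs, sq_abs]
  congr 1
  push_cast
  ring

lemma lintegral_stdGaussian_sub_le {d : ℕ} (v : Vec d) {c : ℝ} (hc : 0 ≤ c) :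
    ∫⁻ z, ENNReal.ofReal (inner ℝ v z - c * ‖v‖) ∂(stdGaussian (Vec d)) ≤
      ENNReal.ofReal (‖v‖ * ((Real.sqrt (2 * Real.pi))⁻¹ * Real.exp (-c ^ 2 / 2))) := by
  rw [← lintegral_map (f := fun y => ENNReal.ofReal (y - c * ‖v‖)) (g := fun z => inner ℝ v z)
    (by fun_prop) (by fun_prop), map_inner_stdGaussian, lintegral_map (by fun_prop) (by fun_prop)]
  have : ∀ y, ENNReal.ofReal (‖v‖ * y - c * ‖v‖) =
      ENNReal.ofReal ‖v‖ * ENNReal.ofReal (y - c) := fun y => by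
    rw [← ENNReal.ofReal_mul (norm_nonneg v)]
    congr 1; ring
  simp_rw [this]
  rw [lintegral_const_mul _ (by fun_prop), ENNReal.ofReal_mul (norm_nonneg v)]
  gcongr
  exact lintegral_gaussianReal_sub_le hc

/-- The width `√(2 log (1/δ))` makes a Gaussian tail at most `δ`, also when `δ > 1`, where the
square root is `0`. -/
lemma exp_neg_sq_sqrt_log_le {δ : ℝ} (hδ : 0 < δ) :
    Real.exp (-Real.sqrt (2 * Real.log (1 / δ)) ^ 2 / 2) ≤ δ := by
  rcases le_total δ 1 with h | h
  · have : 0 ≤ Real.log (1 / δ) := Real.log_nonneg (by rw [le_div_iff₀ hδ]; linarith)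
    rw [Real.sq_sqrt (by positivity), one_div, Real.log_inv]
    rw [show -(2 * -Real.log δ) / 2 = Real.log δ by ring, Real.exp_log hδ]
  · refine le_trans (Real.exp_le_one_iff.2 ?_) h
    have := sq_nonneg (Real.sqrt (2 * Real.log (1 / δ)))
    linarith

lemma two_mul_inv_sqrt_two_pi : 2 * (Real.sqrt (2 * Real.pi))⁻¹ = Real.sqrt (2 / Real.pi) := by
  have hpi := Real.pi_pos
  rw [Real.sqrt_mul two_pos.le, Real.sqrt_div two_pos.le]
  have h2 : Real.sqrt 2 ^ 2 = 2 := Real.sq_sqrt two_pos.le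
  field_simp
  linarith

end Tail

/-! ### Tails of the posterior, uniformly over the actions -/

section PosteriorTail

variable {d t : ℕ} {Sig0 : Matrix (Fin d) (Fin d) ℝ}

/-- The posterior width of an action is the norm of its image under the root of the posterior
covariance. -/
lemma norm_postSqrt_mulVec (hSig0 : Sig0.PosDef) (σ : ℝ) (h : Hist d t) (a : Vec d) :
    ‖(WithLp.toLp 2 (postSqrt Sig0 σ h *ᵥ a.ofLp) : Vec d)‖ = wnorm (postCov Sig0 σ h) a := by
  rw [norm_eq_sqrt_real_inner, wnorm, inner_eq_dotProduct, ← postSqrt_mul_self hSig0 σ h,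
    ← Matrix.mulVec_mulVec, dotProduct_mulVec_comm (postSqrt_isHermitian Sig0 σ h) a.ofLp]

lemma inner_postSqrt_mulVec (σ : ℝ) (h : Hist d t) (a z : Vec d) :
    inner ℝ a (WithLp.toLp 2 (postSqrt Sig0 σ h *ᵥ z.ofLp) : Vec d) =
      inner ℝ (WithLp.toLp 2 (postSqrt Sig0 σ h *ᵥ a.ofLp) : Vec d) z := by
  rw [inner_eq_dotProduct, inner_eq_dotProduct,
    dotProduct_mulVec_comm (postSqrt_isHermitian Sig0 σ h), dotProduct_comm]

/-- The standardized parameter `Σ̂^{-1/2} (x - θ̂)`, in the form `Σ̂^{1/2} Σ̂⁻¹ (x - θ̂)`, which is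
plainly continuous in the history. -/
def standardize (theta0 : Vec d) (Sig0 : Matrix (Fin d) (Fin d) ℝ) (σ : ℝ) (h : Hist d t)
    (x : Vec d) : Vec d :=
  WithLp.toLp 2 (postSqrt Sig0 σ h *ᵥ (postPrec Sig0 σ h *ᵥ
    (x - postMean theta0 Sig0 σ h).ofLp))

lemma continuous_standardize (theta0 : Vec d) (hSig0 : Sig0.PosDef) (σ : ℝ) :
    Continuous fun p : Hist d t × Vec d => standardize theta0 Sig0 σ p.1 p.2 := by
  unfold standardize
  have h1 := (continuous_postMean (t := t) theta0 hSig0 σ).comp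
    (continuous_fst (X := Hist d t) (Y := Vec d))
  have h2 : Continuous fun p : Hist d t × Vec d => (p.2 - postMean theta0 Sig0 σ p.1).ofLp :=
    (PiLp.continuous_ofLp 2 _).comp (continuous_snd.sub h1)
  exact (PiLp.continuous_toLp 2 _).comp
    (((continuous_postSqrt hSig0 σ).comp continuous_fst).matrix_mulVec
      (((continuous_postPrec Sig0 σ).comp continuous_fst).matrix_mulVec h2))

lemma postSqrt_mulVec_standardize (theta0 : Vec d) (hSig0 : Sig0.PosDef) (σ : ℝ) (h : Hist d t)
    (x : Vec d) :
    WithLp.toLp 2 (postSqrt Sig0 σ h *ᵥ (standardize theta0 Sig0 σ h x).ofLp) =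
      x - postMean theta0 Sig0 σ h := by
  rw [standardize, Matrix.mulVec_mulVec, postSqrt_mul_self hSig0, postCov_eq,
    inv_mulVec_mulVec (postPrec_posDef hSig0 σ h)]

lemma standardize_postSample (theta0 : Vec d) (hSig0 : Sig0.PosDef) (σ : ℝ) (h : Hist d t)
    (z : Vec d) : standardize theta0 Sig0 σ h (postSample theta0 Sig0 σ h z) = z := by
  have hdet := (Matrix.isUnit_iff_isUnit_det _).1 (postPrec_posDef hSig0 σ h).isUnit
  have h1 : postSqrt Sig0 σ h * (postSqrt Sig0 σ h * postPrec Sig0 σ h) = 1 := by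
    rw [← mul_assoc, postSqrt_mul_self hSig0, postCov_eq, Matrix.nonsing_inv_mul _ hdet]
  have h2 := mul_eq_one_comm.1 h1
  rw [standardize, postSample, add_sub_cancel_left, Matrix.mulVec_mulVec, Matrix.mulVec_mulVec, h2,
    Matrix.one_mulVec]

lemma inner_sub_postMean (theta0 : Vec d) (hSig0 : Sig0.PosDef) (σ : ℝ) (h : Hist d t)
    (a x : Vec d) : inner ℝ a (x - postMean theta0 Sig0 σ h) =
      inner ℝ (WithLp.toLp 2 (postSqrt Sig0 σ h *ᵥ a.ofLp) : Vec d)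
        (standardize theta0 Sig0 σ h x) := by
  rw [← inner_postSqrt_mulVec, postSqrt_mulVec_standardize theta0 hSig0]

lemma lintegral_posterior_standardize (theta0 : Vec d) (hSig0 : Sig0.PosDef) (σ : ℝ) (h : Hist d t)
    {f : Vec d → ENNReal} (hf : Measurable f) :
    ∫⁻ x, f (standardize theta0 Sig0 σ h x) ∂(posterior theta0 Sig0 σ h) =
      ∫⁻ z, f z ∂(stdGaussian (Vec d)) := by
  have hm : Measurable (standardize theta0 Sig0 σ h) := by
    unfold standardize
    exact ((PiLp.continuous_toLp 2 _).comp (continuous_const.matrix_mulVec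
      (continuous_const.matrix_mulVec (by fun_prop)))).measurable
  have hfm : Measurable fun x => f (standardize theta0 Sig0 σ h x) := hf.comp hm
  rw [posterior_eq_map, lintegral_map hfm (measurable_postSample_right theta0 Sig0 σ h)]
  simp_rw [standardize_postSample theta0 hSig0 σ h]

/-- `T h x` bounds by how much `⟪a, x⟫` exceeds the upper confidence bound with parameter `α`,
uniformly over the actions `a ∈ S`, and has mean at most `τ` when `x` follows the posterior. -/
structure IsTailBound (theta0 : Vec d) (Sig0 : Matrix (Fin d) (Fin d) ℝ) (σ α τ : ℝ)
    (S : Set (Vec d)) (T : Hist d t × Vec d → ℝ) : Prop where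
  measurable : Measurable T
  nonneg : ∀ p, 0 ≤ T p
  inner_le : ∀ h x, ∀ a ∈ S, inner ℝ a (x - postMean theta0 Sig0 σ h) ≤
    α * wnorm (postCov Sig0 σ h) a + T (h, x)
  lintegral_le : ∀ h, ∫⁻ x, ENNReal.ofReal (T (h, x)) ∂(posterior theta0 Sig0 σ h) ≤
    ENNReal.ofReal τ

/-- For finitely many actions the excess is the sum of the excesses of the actions. -/
lemma exists_isTailBound_finite (t : ℕ) (theta0 : Vec d) (hSig0 : Sig0.PosDef) (σ : ℝ)
    {S : Set (Vec d)} {s : ℝ} (hs : ∀ a ∈ S, wnorm Sig0 a ≤ s) {K : ℕ} (hK : S.encard ≤ K)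
    (hs0 : 0 ≤ s) {δ : ℝ} (hδ : 0 < δ) :
    ∃ T : Hist d t × Vec d → ℝ, IsTailBound theta0 Sig0 σ (Real.sqrt (2 * Real.log (1 / δ)))
      (Real.sqrt (2 / Real.pi) * s * K * δ) S T := by
  have hfin : S.Finite := Set.finite_of_encard_le_coe hK
  have hcard : (hfin.toFinset.card : ℝ) ≤ K := by
    have : ((hfin.toFinset.card : ℕ) : ℕ∞) ≤ K := by rwa [← hfin.encard_eq_coe_toFinset_card]
    exact_mod_cast this
  set c := Real.sqrt (2 * Real.log (1 / δ)) with hc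
  have hc0 : 0 ≤ c := Real.sqrt_nonneg _
  set B : Hist d t → Vec d → Vec d := fun h a => WithLp.toLp 2 (postSqrt Sig0 σ h *ᵥ a.ofLp)
  have hB : ∀ a, Continuous fun h => B h a := fun a =>
    (PiLp.continuous_toLp 2 _).comp ((continuous_postSqrt hSig0 σ).matrix_mulVec (by fun_prop))
  have hBn : ∀ h a, ‖B h a‖ = wnorm (postCov Sig0 σ h) a := norm_postSqrt_mulVec hSig0 σ
  have hst := continuous_standardize (t := t) theta0 hSig0 σ
  have hex : ∀ a, Continuous fun p : Hist d t × Vec d =>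
      inner ℝ (B p.1 a) (standardize theta0 Sig0 σ p.1 p.2) - c * ‖B p.1 a‖ := fun a => by
    have := (hB a).comp (continuous_fst (X := Hist d t) (Y := Vec d))
    exact (this.inner hst).sub (continuous_const.mul this.norm)
  refine ⟨fun p => ∑ a ∈ hfin.toFinset,
    max (inner ℝ (B p.1 a) (standardize theta0 Sig0 σ p.1 p.2) - c * ‖B p.1 a‖) 0, ?_, ?_, ?_, ?_⟩
  · exact (continuous_finsetSum _ fun a _ => (hex a).max continuous_const).measurable
  · exact fun p => Finset.sum_nonneg fun a _ => le_max_right _ _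
  · intro h x a ha
    rw [inner_sub_postMean theta0 hSig0, ← hBn]
    have := Finset.single_le_sum (f := fun a =>
      max (inner ℝ (B h a) (standardize theta0 Sig0 σ h x) - c * ‖B h a‖) 0)
      (fun a _ => le_max_right _ _) (hfin.mem_toFinset.2 ha)
    have h2 := (le_max_left _ _).trans this
    linarith
  · intro h
    have hm : ∀ a, Measurable fun z : Vec d => ENNReal.ofReal (inner ℝ (B h a) z - c * ‖B h a‖) :=
      fun a => by fun_prop
    simp only
    rw [lintegral_posterior_standardize theta0 hSig0 σ h (f := fun z => ENNReal.ofReal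
      (∑ a ∈ hfin.toFinset, max (inner ℝ (B h a) z - c * ‖B h a‖) 0)) (by fun_prop)]
    simp_rw [ENNReal.ofReal_sum_of_nonneg fun a _ => le_max_right _ _, ENNReal.ofReal_max,
      ENNReal.ofReal_zero, max_eq_left (zero_le (a := ENNReal.ofReal _))]
    rw [lintegral_finsetSum _ fun a _ => hm a]
    have hterm : ∀ a ∈ hfin.toFinset, ∫⁻ z, ENNReal.ofReal (inner ℝ (B h a) z - c * ‖B h a‖)
        ∂(stdGaussian (Vec d)) ≤ ENNReal.ofReal (Real.sqrt (2 / Real.pi) * s * δ) := by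
      intro a ha
      refine (lintegral_stdGaussian_sub_le (B h a) hc0).trans (ENNReal.ofReal_le_ofReal ?_)
      have h1 : ‖B h a‖ ≤ s := by
        rw [hBn]
        exact (wnorm_postCov_le hSig0 σ h a).trans (hs a (hfin.mem_toFinset.1 ha))
      have h2 := exp_neg_sq_sqrt_log_le hδ
      have h3 : (Real.sqrt (2 * Real.pi))⁻¹ ≤ Real.sqrt (2 / Real.pi) := by
        rw [← two_mul_inv_sqrt_two_pi]
        have : 0 ≤ (Real.sqrt (2 * Real.pi))⁻¹ := by positivity
        linarith
      calc ‖B h a‖ * ((Real.sqrt (2 * Real.pi))⁻¹ * Real.exp (-c ^ 2 / 2))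
          ≤ s * (Real.sqrt (2 / Real.pi) * δ) := by gcongr
        _ = Real.sqrt (2 / Real.pi) * s * δ := by ring
    refine (Finset.sum_le_card_nsmul _ _ _ hterm).trans ?_
    rw [nsmul_eq_mul, ← ENNReal.ofReal_natCast, ← ENNReal.ofReal_mul (by positivity)]
    refine ENNReal.ofReal_le_ofReal ?_
    calc (hfin.toFinset.card : ℝ) * (Real.sqrt (2 / Real.pi) * s * δ)
        ≤ K * (Real.sqrt (2 / Real.pi) * s * δ) := by gcongr
      _ = _ := by ring

lemma norm_le_sqrt_mul_of_abs_le {z : Vec d} {r : ℝ} (hr : 0 ≤ r) (h : ∀ i, |z i| ≤ r) :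
    ‖z‖ ≤ Real.sqrt d * r := by
  rw [EuclideanSpace.norm_eq, ← Real.sqrt_sq hr, ← Real.sqrt_mul (Nat.cast_nonneg d)]
  refine Real.sqrt_le_sqrt ?_
  calc ∑ i, ‖z i‖ ^ 2 ≤ ∑ _i : Fin d, r ^ 2 := by
        refine Finset.sum_le_sum fun i _ => ?_
        rw [Real.norm_eq_abs]
        exact pow_le_pow_left₀ (abs_nonneg _) (h i) 2
    _ = d * r ^ 2 := by simp

/-- For an arbitrary action set, Cauchy-Schwarz reduces the excess to the standardized parameter
`z`, and `‖z‖ ≤ √d maxᵢ |zᵢ| ≤ √d (c + ∑ᵢ (|zᵢ| - c)₊)`. -/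
lemma exists_isTailBound_bounded (t : ℕ) (theta0 : Vec d) (hSig0 : Sig0.PosDef) (σ : ℝ)
    {S : Set (Vec d)} {s : ℝ} (hs : ∀ a ∈ S, wnorm Sig0 a ≤ s) (hs0 : 0 ≤ s) {δ : ℝ}
    (hδ : 0 < δ) :
    ∃ T : Hist d t × Vec d → ℝ, IsTailBound theta0 Sig0 σ
      (Real.sqrt (2 * d * Real.log (1 / δ)))
      (Real.sqrt (2 / Real.pi) * s * (d : ℝ) ^ (3 / 2 : ℝ) * δ) S T := by
  set c := Real.sqrt (2 * Real.log (1 / δ)) with hc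
  have hc0 : 0 ≤ c := Real.sqrt_nonneg _
  have hα : Real.sqrt (2 * d * Real.log (1 / δ)) = Real.sqrt d * c := by
    rw [hc, ← Real.sqrt_mul (Nat.cast_nonneg d)]
    congr 1; ring
  -- the two tails of the coordinate `zᵢ` are the upper tails in the directions `eᵢ` and `-eᵢ`
  set e : Fin d → Vec d := fun i => EuclideanSpace.single i 1 with he
  have hen : ∀ i, ‖e i‖ = 1 := fun i => by simp [he]
  have hei : ∀ i (z : Vec d), inner ℝ (e i) z = z i := fun i z => by simp [he, inner_eq_dotProduct]
  have hst := continuous_standardize (t := t) theta0 hSig0 σ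
  set R : Vec d → ℝ := fun z => ∑ i, (max (inner ℝ (e i) z - c * ‖e i‖) 0 +
    max (inner ℝ (-e i) z - c * ‖-e i‖) 0) with hR
  have hRc : Continuous R := by fun_prop
  have hRt : ∀ i z, 0 ≤ max (inner ℝ (e i) z - c * ‖e i‖) 0 +
    max (inner ℝ (-e i) z - c * ‖-e i‖) 0 :=
    fun i z => add_nonneg (le_max_right _ _) (le_max_right _ _)
  have hR0 : ∀ z, 0 ≤ R z := fun z => Finset.sum_nonneg fun i _ => hRt i z
  have hRi : ∀ z i, |z i| ≤ c + R z := by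
    intro z i
    have h1 : max (inner ℝ (e i) z - c * ‖e i‖) 0 +
        max (inner ℝ (-e i) z - c * ‖-e i‖) 0 ≤ R z :=
      Finset.single_le_sum (f := fun i => max (inner ℝ (e i) z - c * ‖e i‖) 0 +
        max (inner ℝ (-e i) z - c * ‖-e i‖) 0) (fun i _ => hRt i z) (Finset.mem_univ i)
    rw [inner_neg_left, norm_neg, hei, hen, mul_one] at h1
    rw [abs_le]
    constructor <;>
    linarith [le_max_left (z i - c) 0, le_max_left (-z i - c) 0, le_max_right (z i - c) 0,
      le_max_right (-z i - c) 0]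
  refine ⟨fun p => s * Real.sqrt d * R (standardize theta0 Sig0 σ p.1 p.2), ?_, ?_, ?_, ?_⟩
  · exact (continuous_const.mul (hRc.comp hst)).measurable
  · exact fun p => mul_nonneg (by positivity) (hR0 _)
  · intro h x a ha
    rw [inner_sub_postMean theta0 hSig0, hα]
    refine (real_inner_le_norm _ _).trans ?_
    rw [norm_postSqrt_mulVec hSig0]
    set z := standardize theta0 Sig0 σ h x
    have h1 := norm_le_sqrt_mul_of_abs_le (add_nonneg hc0 (hR0 z)) (hRi z)
    have h2 : wnorm (postCov Sig0 σ h) a ≤ s := (wnorm_postCov_le hSig0 σ h a).trans (hs a ha)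
    have h3 : 0 ≤ wnorm (postCov Sig0 σ h) a := Real.sqrt_nonneg _
    have h4 := hR0 z
    calc wnorm (postCov Sig0 σ h) a * ‖z‖
        ≤ wnorm (postCov Sig0 σ h) a * (Real.sqrt d * (c + R z)) := by gcongr
      _ = Real.sqrt d * c * wnorm (postCov Sig0 σ h) a +
          wnorm (postCov Sig0 σ h) a * Real.sqrt d * R z := by ring
      _ ≤ _ := by gcongr
  · intro h
    have hm : ∀ v : Vec d, Measurable fun z : Vec d =>
        ENNReal.ofReal (inner ℝ v z - c * ‖v‖) := fun v => by fun_prop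
    simp only
    rw [lintegral_posterior_standardize theta0 hSig0 σ h
      (f := fun z => ENNReal.ofReal (s * Real.sqrt d * R z)) (by fun_prop)]
    simp_rw [ENNReal.ofReal_mul (by positivity : 0 ≤ s * Real.sqrt d)]
    rw [lintegral_const_mul _ (by fun_prop)]
    simp_rw [hR, ENNReal.ofReal_sum_of_nonneg fun i _ => hRt i _,
      ENNReal.ofReal_add (le_max_right _ _) (le_max_right _ _), ENNReal.ofReal_max,
      ENNReal.ofReal_zero, max_eq_left (zero_le (a := ENNReal.ofReal _))]
    have hm2 : ∀ i : Fin d, Measurable fun z : Vec d =>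
        ENNReal.ofReal (inner ℝ (e i) z - c * ‖e i‖) +
          ENNReal.ofReal (inner ℝ (-e i) z - c * ‖-e i‖) := fun i => by fun_prop
    rw [lintegral_finsetSum _ fun i _ => hm2 i]
    have hterm : ∀ v : Vec d, ‖v‖ = 1 → ∫⁻ z, ENNReal.ofReal (inner ℝ v z - c * ‖v‖)
        ∂(stdGaussian (Vec d)) ≤ ENNReal.ofReal ((Real.sqrt (2 * Real.pi))⁻¹ * δ) := by
      intro v hv
      refine (lintegral_stdGaussian_sub_le v hc0).trans (ENNReal.ofReal_le_ofReal ?_)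
      rw [hv, one_mul]
      gcongr
      exact exp_neg_sq_sqrt_log_le hδ
    have hsum : ∑ i, ∫⁻ z, (ENNReal.ofReal (inner ℝ (e i) z - c * ‖e i‖) +
        ENNReal.ofReal (inner ℝ (-e i) z - c * ‖-e i‖)) ∂(stdGaussian (Vec d)) ≤
        ENNReal.ofReal (d * (Real.sqrt (2 / Real.pi) * δ)) := by
      have : ∀ i ∈ Finset.univ, ∫⁻ z, (ENNReal.ofReal (inner ℝ (e i) z - c * ‖e i‖) +
        ENNReal.ofReal (inner ℝ (-e i) z - c * ‖-e i‖)) ∂(stdGaussian (Vec d)) ≤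
        ENNReal.ofReal (Real.sqrt (2 / Real.pi) * δ) := by
        intro i _
        rw [lintegral_add_left (hm _)]
        refine (add_le_add (hterm (e i) (hen i)) (hterm (-e i) (by rw [norm_neg, hen]))).trans ?_
        rw [← ENNReal.ofReal_add (by positivity) (by positivity), ← two_mul_inv_sqrt_two_pi]
        exact ENNReal.ofReal_le_ofReal (by linarith)
      refine (Finset.sum_le_card_nsmul _ _ _ this).trans ?_
      rw [nsmul_eq_mul, ← ENNReal.ofReal_natCast, ← ENNReal.ofReal_mul (by positivity)]
      simp
    refine (mul_le_mul_right hsum _).trans ?_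
    rw [← ENNReal.ofReal_mul (by positivity)]
    refine ENNReal.ofReal_le_ofReal (le_of_eq ?_)
    have : (d : ℝ) ^ (3 / 2 : ℝ) = d * Real.sqrt d := by
      rw [show (3 / 2 : ℝ) = 1 + 1 / 2 by norm_num,
        Real.rpow_add_of_nonneg (Nat.cast_nonneg d) (by norm_num) (by norm_num), Real.rpow_one,
        Real.sqrt_eq_rpow]
    rw [this]
    ring

end PosteriorTail

/-! ### The elliptical potential -/

section Potential

variable {d : ℕ} {Sig0 : Matrix (Fin d) (Fin d) ℝ}

lemma wnorm_nonneg (M : Matrix (Fin d) (Fin d) ℝ) (a : Vec d) : 0 ≤ wnorm M a :=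
  Real.sqrt_nonneg _

lemma sq_wnorm {S : Matrix (Fin d) (Fin d) ℝ} (hS : S.PosSemidef) (a : Vec d) :
    wnorm S a ^ 2 = a.ofLp ⬝ᵥ S *ᵥ a.ofLp :=
  Real.sq_sqrt (by simpa using hS.dotProduct_mulVec_nonneg a.ofLp)

/-- The matrix determinant lemma, for the precision matrix after one more action. -/
lemma det_postPrec_snoc {t : ℕ} (hSig0 : Sig0.PosDef) (σ : ℝ) (h : Hist d t) (a : Vec d) (y : ℝ) :
    (postPrec Sig0 σ (h.snoc a y)).det =
      (postPrec Sig0 σ h).det * (1 + wnorm (postCov Sig0 σ h) a ^ 2 / σ ^ 2) := by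
  have hdet := (Matrix.isUnit_iff_isUnit_det _).1 (postPrec_posDef hSig0 σ h).isUnit
  have h1 : postPrec Sig0 σ (h.snoc a y) = postPrec Sig0 σ h * (1 +
      Matrix.replicateCol Unit ((σ ^ 2)⁻¹ • (postCov Sig0 σ h *ᵥ a.ofLp)) *
        Matrix.replicateRow Unit a.ofLp) := by
    rw [postPrec_snoc, mul_add, mul_one, ← Matrix.vecMulVec_eq, Matrix.smul_vecMulVec,
      Matrix.mul_smul, Matrix.mul_vecMulVec, postCov_eq,
      mulVec_inv_mulVec (postPrec_posDef hSig0 σ h)]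
  rw [h1, Matrix.det_mul, Matrix.det_one_add_replicateCol_mul_replicateRow,
    sq_wnorm (postCov_posDef hSig0 σ h).posSemidef, dotProduct_smul, smul_eq_mul, div_eq_inv_mul]

lemma log_det_postPrec_history {Ω : Type*} (hSig0 : Sig0.PosDef) (σ : ℝ) (A : ℕ → Ω → Vec d)
    (Y : ℕ → Ω → ℝ) (ω : Ω) (n : ℕ) :
    Real.log (postPrec Sig0 σ (history A Y n ω)).det = Real.log (Sig0⁻¹).det +
      ∑ t ∈ Finset.range n,
        Real.log (1 + wnorm (postCov Sig0 σ (history A Y t ω)) (A t ω) ^ 2 / σ ^ 2) := by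
  induction n with
  | zero => simp [postPrec_zero]
  | succ n ih =>
    rw [history_succ, det_postPrec_snoc hSig0, Real.log_mul
      (postPrec_posDef hSig0 σ _).det_pos.ne' (by positivity), ih, Finset.sum_range_succ, add_assoc]

/-- The inequality of arithmetic and geometric means for the eigenvalues. -/
lemma det_le_trace_div_pow {M : Matrix (Fin d) (Fin d) ℝ} (hM : M.PosSemidef) :
    M.det ≤ (M.trace / d) ^ d := by
  rcases Nat.eq_zero_or_pos d with rfl | hd
  · simp
  have hd' : (0 : ℝ) < d := by exact_mod_cast hd
  have h := Real.geom_mean_le_arith_mean_weighted Finset.univ (fun _ : Fin d => (d : ℝ)⁻¹)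
    hM.1.eigenvalues (fun _ _ => by positivity) (by simp [hd'.ne'])
    (fun i _ => hM.eigenvalues_nonneg i)
  rw [← Finset.mul_sum, Real.finsetProd_rpow _ _ fun i _ => hM.eigenvalues_nonneg i] at h
  have h0 : 0 ≤ ∏ i, hM.1.eigenvalues i := Finset.prod_nonneg fun i _ => hM.eigenvalues_nonneg i
  rw [hM.1.det_eq_prod_eigenvalues, hM.1.trace_eq_sum_eigenvalues]
  simp only [RCLike.ofReal_real_eq_id, id_eq]
  calc ∏ i, hM.1.eigenvalues i
      = ((∏ i, hM.1.eigenvalues i) ^ (d : ℝ)⁻¹) ^ d := (Real.rpow_inv_natCast_pow h0 hd.ne').symm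
    _ ≤ _ := by
      refine pow_le_pow_left₀ (Real.rpow_nonneg h0 _) ?_ d
      rwa [div_eq_inv_mul]

open scoped MatrixOrder in
lemma log_det_postPrec_le {n : ℕ} (hSig0 : Sig0.PosDef) {σ s : ℝ} (h : Hist d n)
    (hs : ∀ l, wnorm Sig0 (h l).1 ≤ s) :
    Real.log (postPrec Sig0 σ h).det - Real.log (Sig0⁻¹).det ≤
      d * Real.log (1 + s ^ 2 * n / (σ ^ 2 * d)) := by
  rcases Nat.eq_zero_or_pos d with rfl | hd
  · simp
  have hd' : (0 : ℝ) < d := by exact_mod_cast hd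
  -- `Q P Q`, with `Q` the root of the prior covariance, has trace `d + σ⁻² ∑ ‖Aₗ‖²`
  set Q := CFC.sqrt Sig0 with hQ
  have hQQ : Q * Q = Sig0 := CFC.sqrt_mul_sqrt_self _ hSig0.posSemidef.nonneg
  have hQh : Q.IsHermitian := (CFC.sqrt_nonneg Sig0).isSelfAdjoint
  have hP := postPrec_posDef hSig0 σ h
  have hM : (Q * postPrec Sig0 σ h * Q).PosSemidef := by
    have := hP.posSemidef.mul_mul_conjTranspose_same Q
    rwa [hQh.eq] at this
  have hdet : (Q * postPrec Sig0 σ h * Q).det = (postPrec Sig0 σ h).det * Sig0.det := by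
    rw [Matrix.det_mul, Matrix.det_mul, ← hQQ, Matrix.det_mul]
    ring
  have hunit := (Matrix.isUnit_iff_isUnit_det _).1 hSig0.isUnit
  have htr : (Q * postPrec Sig0 σ h * Q).trace = d + (σ ^ 2)⁻¹ * ∑ l, wnorm Sig0 (h l).1 ^ 2 := by
    rw [mul_assoc, Matrix.trace_mul_comm, mul_assoc, hQQ, postPrec, add_mul, Matrix.trace_add,
      Matrix.nonsing_inv_mul _ hunit, Matrix.trace_one, Fintype.card_fin, Matrix.smul_mul,
      Matrix.trace_smul, Matrix.sum_mul, Matrix.trace_sum, smul_eq_mul]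
    congr 2
    refine Finset.sum_congr rfl fun l _ => ?_
    rw [Matrix.trace_mul_comm, Matrix.mul_vecMulVec, Matrix.trace_vecMulVec, dotProduct_comm,
      sq_wnorm hSig0.posSemidef]
  have hsum : ∑ l, wnorm Sig0 (h l).1 ^ 2 ≤ n * s ^ 2 := by
    calc ∑ l, wnorm Sig0 (h l).1 ^ 2 ≤ ∑ _l : Fin n, s ^ 2 :=
          Finset.sum_le_sum fun l _ => pow_le_pow_left₀ (wnorm_nonneg _ _) (hs l) 2
      _ = n * s ^ 2 := by simp
  have hle : (postPrec Sig0 σ h).det * Sig0.det ≤ (1 + s ^ 2 * n / (σ ^ 2 * d)) ^ d := by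
    rw [← hdet]
    refine (det_le_trace_div_pow hM).trans (pow_le_pow_left₀ (div_nonneg hM.trace_nonneg hd'.le)
      ?_ d)
    rw [htr, add_div, div_self hd'.ne']
    calc 1 + (σ ^ 2)⁻¹ * (∑ l, wnorm Sig0 (h l).1 ^ 2) / d
        ≤ 1 + (σ ^ 2)⁻¹ * (n * s ^ 2) / d := by gcongr
      _ = 1 + s ^ 2 * n / (σ ^ 2 * d) := by
          rw [div_eq_mul_inv, div_eq_mul_inv, mul_inv]
          ring
  have hlog := Real.log_le_log (mul_pos hP.det_pos hSig0.det_pos) hle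
  rw [Real.log_mul hP.det_pos.ne' hSig0.det_pos.ne', Real.log_pow] at hlog
  rw [Matrix.det_nonsing_inv, Ring.inverse_eq_inv', Real.log_inv]
  linarith

/-- On `[0, u]` the concave function `log (1 + x)` lies above its chord. -/
lemma mul_log_one_add_le {x u : ℝ} (hx : 0 ≤ x) (hxu : x ≤ u) :
    x * Real.log (1 + u) ≤ u * Real.log (1 + x) := by
  rcases (hx.trans hxu).eq_or_lt with h0 | hu
  · have : x = 0 := le_antisymm (h0 ▸ hxu) hx
    simp [this, ← h0]
  have hxu1 : 0 ≤ 1 - x / u := by rwa [sub_nonneg, div_le_one hu]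
  have hc := strictConcaveOn_log_Ioi.concaveOn.2 (Set.mem_Ioi.2 one_pos)
    (Set.mem_Ioi.2 (by linarith : 0 < 1 + u)) hxu1 (div_nonneg hx hu.le) (by ring)
  have h1 : (1 - x / u) * 1 + x / u * (1 + u) = 1 + x := by field_simp; ring
  simp only [smul_eq_mul, Real.log_one, mul_zero, zero_add] at hc
  rw [h1] at hc
  calc x * Real.log (1 + u) = u * (x / u * Real.log (1 + u)) := by field_simp
    _ ≤ _ := by gcongr

/-- The elliptical potential lemma: the squared posterior widths of the actions taken have a sum
that is logarithmic in the number of rounds. -/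
theorem sum_sq_wnorm_le {Ω : Type*} (hSig0 : Sig0.PosDef) {σ s : ℝ} (hσ : 0 < σ) (hs0 : 0 < s)
    (A : ℕ → Ω → Vec d) (Y : ℕ → Ω → ℝ) (ω : Ω) (n : ℕ)
    (hs : ∀ t < n, wnorm Sig0 (A t ω) ≤ s) :
    ∑ t ∈ Finset.range n, wnorm (postCov Sig0 σ (history A Y t ω)) (A t ω) ^ 2 ≤
      s ^ 2 / Real.log (1 + s ^ 2 / σ ^ 2) * (d * Real.log (1 + s ^ 2 * n / (σ ^ 2 * d))) := by
  have hlog : 0 < Real.log (1 + s ^ 2 / σ ^ 2) := Real.log_pos (by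
    have : 0 < s ^ 2 / σ ^ 2 := by positivity
    linarith)
  have hterm : ∀ t ∈ Finset.range n,
      wnorm (postCov Sig0 σ (history A Y t ω)) (A t ω) ^ 2 ≤
        s ^ 2 / Real.log (1 + s ^ 2 / σ ^ 2) *
          Real.log (1 + wnorm (postCov Sig0 σ (history A Y t ω)) (A t ω) ^ 2 / σ ^ 2) := by
    intro t ht
    set w := wnorm (postCov Sig0 σ (history A Y t ω)) (A t ω)
    have hw0 : 0 ≤ w := wnorm_nonneg _ _
    have hw : w ≤ s := (wnorm_postCov_le hSig0 σ _ _).trans (hs t (Finset.mem_range.1 ht))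
    have h := mul_log_one_add_le (x := w ^ 2 / σ ^ 2) (u := s ^ 2 / σ ^ 2) (by positivity)
      (by gcongr)
    rw [div_mul_eq_mul_div, div_mul_eq_mul_div, div_le_div_iff_of_pos_right (by positivity)] at h
    rw [div_mul_eq_mul_div, le_div_iff₀ hlog]
    exact h
  refine (Finset.sum_le_sum hterm).trans ?_
  rw [← Finset.mul_sum]
  gcongr
  have h1 := log_det_postPrec_history hSig0 σ A Y ω n
  have h2 := log_det_postPrec_le hSig0 (σ := σ) (history A Y n ω) (s := s) fun l => hs l l.2
  linarith

lemma sum_wnorm_le {Ω : Type*} (hSig0 : Sig0.PosDef) {σ s : ℝ} (hσ : 0 < σ) (hs0 : 0 ≤ s)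
    (A : ℕ → Ω → Vec d) (Y : ℕ → Ω → ℝ) (ω : Ω) (n : ℕ)
    (hs : ∀ t < n, wnorm Sig0 (A t ω) ≤ s) :
    ∑ t ∈ Finset.range n, wnorm (postCov Sig0 σ (history A Y t ω)) (A t ω) ≤
      s * Real.sqrt (n * (d * Real.log (1 + s ^ 2 * n / (σ ^ 2 * d)) /
        Real.log (1 + s ^ 2 / σ ^ 2))) := by
  rcases hs0.eq_or_lt with rfl | hs0
  · rw [zero_mul]
    exact Finset.sum_nonpos fun t ht =>
      (wnorm_postCov_le hSig0 σ _ _).trans (hs t (Finset.mem_range.1 ht))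
  have h1 := sum_sq_wnorm_le hSig0 hσ hs0 A Y ω n hs
  have h2 := sq_sum_le_card_mul_sum_sq (s := Finset.range n)
    (f := fun t => wnorm (postCov Sig0 σ (history A Y t ω)) (A t ω))
  rw [Finset.card_range] at h2
  rw [← Real.sqrt_sq hs0.le, ← Real.sqrt_mul (by positivity), Real.sqrt_sq hs0.le]
  refine Real.le_sqrt_of_sq_le (h2.trans ?_)
  calc (n : ℝ) * ∑ t ∈ Finset.range n, wnorm (postCov Sig0 σ (history A Y t ω)) (A t ω) ^ 2
      ≤ n * (s ^ 2 / Real.log (1 + s ^ 2 / σ ^ 2) *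
        (d * Real.log (1 + s ^ 2 * n / (σ ^ 2 * d)))) := by gcongr
    _ = _ := by ring

end Potential

/-! ### The regret of one round -/

section Support

variable {d : ℕ} {S : Set (Vec d)}

/-- The value of the best action in `S` when the parameter is `x`.  The real supremum is `0` for
empty `S`; for bounded nonempty `S` it is the genuine one. -/
def bestValue (S : Set (Vec d)) (x : Vec d) : ℝ :=
  sSup ((fun a => inner ℝ a x) '' S)

lemma IsArgmax.bestValue_eq {a x : Vec d} (h : IsArgmax S (fun a => inner ℝ a x) a) :
    bestValue S x = inner ℝ a x :=
  IsGreatest.csSup_eq ⟨Set.mem_image_of_mem _ h.1, by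
    rintro _ ⟨b, hb, rfl⟩
    exact h.2 hb⟩

lemma continuous_bestValue {C : ℝ} (hC : ∀ a ∈ S, ‖a‖ ≤ C) : Continuous (bestValue S) := by
  rcases S.eq_empty_or_nonempty with rfl | hne
  · have : bestValue (∅ : Set (Vec d)) = fun _ => sSup ∅ := by
      funext x
      rw [bestValue, Set.image_empty]
    rw [this]
    exact continuous_const
  · have hC0 : 0 ≤ C := (norm_nonneg _).trans (hC _ hne.some_mem)
    refine (LipschitzWith.of_le_add_mul (Real.toNNReal C) fun x y => ?_).continuous
    rw [Real.coe_toNNReal _ hC0, dist_eq_norm]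
    refine csSup_le (hne.image _) ?_
    rintro _ ⟨a, ha, rfl⟩
    have hbdd : BddAbove ((fun a => inner ℝ a y) '' S) := by
      refine ⟨C * ‖y‖, ?_⟩
      rintro _ ⟨b, hb, rfl⟩
      exact (real_inner_le_norm b y).trans
        (mul_le_mul_of_nonneg_right (hC b hb) (norm_nonneg y))
    have h1 : inner ℝ a y ≤ bestValue S y := le_csSup hbdd (Set.mem_image_of_mem _ ha)
    have h2 : inner ℝ a (x - y) ≤ C * ‖x - y‖ := (real_inner_le_norm _ _).trans
      (mul_le_mul_of_nonneg_right (hC a ha) (norm_nonneg _))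
    rw [inner_sub_right] at h2
    simp only
    linarith

end Support

section Round

variable {Ω : Type*} [MeasurableSpace Ω] {μ : Measure Ω}
  {d n : ℕ} {theta0 : Vec d} {Sig0 : Matrix (Fin d) (Fin d) ℝ} {σ α τ : ℝ}
  {F : ℕ → Set (Vec d)} {θs : Ω → Vec d} {A Astar : ℕ → Ω → Vec d} {Y ε : ℕ → Ω → ℝ}

lemma IsLinearBandit.integrable_param (hb : IsLinearBandit μ n theta0 Sig0 σ F θs A Y ε) :
    Integrable θs μ := by
  have h1 : Integrable id (μ.map θs) := by
    rw [hb.prior]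
    exact IsGaussian.integrable_id
  exact (integrable_map_measure (by fun_prop) hb.measurable_param.aemeasurable).1 h1

lemma IsLinearBandit.measurable_wnorm (hb : IsLinearBandit μ n theta0 Sig0 σ F θs A Y ε)
    (hSig0 : Sig0.PosDef) {t : ℕ} (ht : t < n) :
    Measurable fun ω => wnorm (postCov Sig0 σ (history A Y t ω)) (A t ω) := by
  have hc : Continuous fun p : Hist d t × Vec d => wnorm (postCov Sig0 σ p.1) p.2 := by
    unfold wnorm
    refine Real.continuous_sqrt.comp (Continuous.dotProduct (by fun_prop) ?_)
    exact ((continuous_postCov hSig0 σ).comp continuous_fst).matrix_mulVec (by fun_prop)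
  exact hc.measurable.comp ((hb.measurable_history ht.le).prodMk (hb.measurable_action t ht))

lemma IsLinearBandit.integrable_inner_action (hb : IsLinearBandit μ n theta0 Sig0 σ F θs A Y ε)
    {t : ℕ} (ht : t < n) {C : ℝ} (hC : ∀ a ∈ F t, ‖a‖ ≤ C) :
    Integrable (fun ω => inner ℝ (A t ω) (θs ω)) μ := by
  have hm := (hb.measurable_action t ht).inner hb.measurable_param (𝕜 := ℝ)
  refine (hb.integrable_param.norm.const_mul C).mono' hm.aestronglyMeasurable ?_
  filter_upwards [hb.action_mem t ht] with ω hω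
  exact (norm_inner_le_norm _ _).trans (mul_le_mul_of_nonneg_right (hC _ hω) (norm_nonneg _))

lemma IsLinearBandit.integrable_bestValue
    (hb : IsLinearBandit μ n theta0 Sig0 σ F θs A Y ε) {t : ℕ} {C : ℝ}
    (hC : ∀ a ∈ F t, ‖a‖ ≤ C)
    (hAstar : ∀ᵐ ω ∂μ, IsArgmax (F t) (fun a => inner ℝ a (θs ω)) (Astar t ω)) :
    Integrable (fun ω => bestValue (F t) (θs ω)) μ := by
  refine (hb.integrable_param.norm.const_mul C).mono'
    ((continuous_bestValue hC).measurable.comp hb.measurable_param).aestronglyMeasurable ?_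
  filter_upwards [hAstar] with ω hω
  rw [hω.bestValue_eq]
  exact (norm_inner_le_norm _ _).trans (mul_le_mul_of_nonneg_right (hC _ hω.1) (norm_nonneg _))

variable [IsProbabilityMeasure μ]

lemma IsTailBound.integrable_comp {t : ℕ} {S : Set (Vec d)} {T : Hist d t × Vec d → ℝ}
    (hT : IsTailBound theta0 Sig0 σ α τ S T) (hSig0 : Sig0.PosDef) {X : Ω → Vec d}
    {H : Ω → Hist d t} (hH : Measurable H)
    (hX : HasCondDistrib X H (postKernel t theta0 hSig0 σ) μ) (hτ : 0 ≤ τ) :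
    Integrable (fun ω => T (H ω, X ω)) μ ∧ ∫ ω, T (H ω, X ω) ∂μ ≤ τ := by
  have hm : AEStronglyMeasurable (fun ω => T (H ω, X ω)) μ :=
    (hT.measurable.comp_aemeasurable hX.aemeasurable).aestronglyMeasurable
  have h0 : 0 ≤ᵐ[μ] fun ω => T (H ω, X ω) := Filter.Eventually.of_forall fun ω => hT.nonneg _
  have hle : ∫⁻ ω, ENNReal.ofReal (T (H ω, X ω)) ∂μ ≤ ENNReal.ofReal τ := by
    rw [HasCondDistrib.lintegral_eq (f := fun p => ENNReal.ofReal (T p)) hX hH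
      hT.measurable.ennreal_ofReal]
    calc _ ≤ ∫⁻ _ : Ω, ENNReal.ofReal τ ∂μ := lintegral_mono fun ω => hT.lintegral_le (H ω)
      _ = ENNReal.ofReal τ := by simp
  refine ⟨⟨hm, (hasFiniteIntegral_iff_ofReal h0).2 (hle.trans_lt ENNReal.ofReal_lt_top)⟩, ?_⟩
  rw [integral_eq_lintegral_of_nonneg_ae h0 hm]
  exact ENNReal.toReal_le_of_le_ofReal hτ hle

/-- The property of an algorithm that bounds its regret.  In every round there is a vector `X`
which, given the history, follows the posterior just as the true parameter does, and whose best
value exceeds the posterior mean value of the action taken by at most `α` posterior widths of that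
action, plus the tail.  LinTS has it with its sample `X`, LinUCB with the true parameter. -/
def IsOptimistic (μ : Measure Ω) (n : ℕ) (theta0 : Vec d) (hSig0 : Sig0.PosDef) (σ α : ℝ)
    (F : ℕ → Set (Vec d)) (A : ℕ → Ω → Vec d) (Y : ℕ → Ω → ℝ) : Prop :=
  ∀ t < n, ∃ X : Ω → Vec d, HasCondDistrib X (history A Y t) (postKernel t theta0 hSig0 σ) μ ∧
    ∀ τ T, IsTailBound theta0 Sig0 σ α τ (F t) T → ∀ᵐ ω ∂μ, bestValue (F t) (X ω) ≤
      inner ℝ (A t ω) (postMean theta0 Sig0 σ (history A Y t ω)) +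
        α * wnorm (postCov Sig0 σ (history A Y t ω)) (A t ω) + T (history A Y t ω, X ω)

lemma IsLinTS.isOptimistic (h : IsLinTS μ n theta0 Sig0 σ F θs A Y) (hSig0 : Sig0.PosDef) :
    IsOptimistic μ n theta0 hSig0 σ α F A Y := by
  obtain ⟨θt, h⟩ := h
  intro t ht
  obtain ⟨-, ⟨κ, hκ, hpost, hd⟩, hmax⟩ := h t ht
  have hfst : κ.fst = postKernel t theta0 hSig0 σ := by
    ext1 h
    rw [Kernel.fst_apply, hpost, postKernel_apply]
  have h1 := hd.fst
  rw [Kernel.fst_prodMkLeft, hfst] at h1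
  refine ⟨θt t, HasCondDistrib.comp_right (hf := measurable_snd) h1, fun τ T hT => ?_⟩
  filter_upwards [hmax] with ω hω
  have h2 := hT.inner_le (history A Y t ω) (θt t ω) (A t ω) hω.1
  rw [inner_sub_right] at h2
  rw [hω.bestValue_eq]
  linarith

lemma IsLinUCB.isOptimistic (h : IsLinUCB μ n theta0 Sig0 σ α F θs A Y) (hSig0 : Sig0.PosDef)
    (hσ : 0 < σ) (hb : IsLinearBandit μ n theta0 Sig0 σ F θs A Y ε)
    (hAstar : ∀ t < n, ∀ᵐ ω ∂μ, IsArgmax (F t) (fun a => inner ℝ a (θs ω)) (Astar t ω)) :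
    IsOptimistic μ n theta0 hSig0 σ α F A Y := by
  intro t ht
  refine ⟨θs, hb.hasCondDistrib_history hSig0 hσ h.isHistoryBased ht.le, fun τ T hT => ?_⟩
  filter_upwards [(h t ht).2, hAstar t ht] with ω hω hω'
  have h1 := hT.inner_le (history A Y t ω) (θs ω) (Astar t ω) hω'.1
  have h2 : ucb theta0 Sig0 σ α (history A Y t ω) (Astar t ω) ≤
    ucb theta0 Sig0 σ α (history A Y t ω) (A t ω) := hω.2 hω'.1
  rw [inner_sub_right] at h1
  simp only [ucb] at h2
  rw [hω'.bestValue_eq]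
  linarith

/-- Given the history, the mean reward of the action taken is its value at the posterior mean. -/
lemma IsLinearBandit.integral_inner_action (hb : IsLinearBandit μ n theta0 Sig0 σ F θs A Y ε)
    (hSig0 : Sig0.PosDef) (hσ : 0 < σ) (hA : IsHistoryBased μ n θs A Y)
    {t : ℕ} (ht : t < n) {C : ℝ} (hC : ∀ a ∈ F t, ‖a‖ ≤ C) :
    Integrable (fun ω => inner ℝ (A t ω) (postMean theta0 Sig0 σ (history A Y t ω))) μ ∧
      ∫ ω, inner ℝ (A t ω) (θs ω) ∂μ =
        ∫ ω, inner ℝ (A t ω) (postMean theta0 Sig0 σ (history A Y t ω)) ∂μ := by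
  have hint := hb.integrable_inner_action ht hC
  have hcd := hb.hasCondDistrib_action hSig0 hσ hA ht
  have hX := (hb.measurable_history ht.le).prodMk (hb.measurable_action t ht)
  have hf : Measurable fun p : (Hist d t × Vec d) × Vec d => (inner ℝ p.1.2 p.2 : ℝ) := by
    fun_prop
  have hin : ∀ (h : Hist d t) (a : Vec d),
      ∫ x, inner ℝ a x ∂(posterior theta0 Sig0 σ h) = inner ℝ a (postMean theta0 Sig0 σ h) := by
    intro h a
    rw [posterior, integral_inner (f := fun x => x) IsGaussian.integrable_id,
      integral_id_multivariateGaussian]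
  have h1 := HasCondDistrib.integrable_integral hcd hX hf hint
  have h2 := HasCondDistrib.integral_eq hcd hX hf hint
  simp only [Kernel.prodMkRight_apply, postKernel_apply, hin] at h1 h2
  exact ⟨h1, h2⟩

lemma IsLinearBandit.integrable_wnorm (hb : IsLinearBandit μ n theta0 Sig0 σ F θs A Y ε)
    (hSig0 : Sig0.PosDef) {s : ℝ} {t : ℕ} (ht : t < n) (hs : ∀ a ∈ F t, wnorm Sig0 a ≤ s) :
    Integrable (fun ω => wnorm (postCov Sig0 σ (history A Y t ω)) (A t ω)) μ := by
  refine (integrable_const s).mono' (hb.measurable_wnorm hSig0 ht).aestronglyMeasurable ?_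
  filter_upwards [hb.action_mem t ht] with ω hω
  rw [Real.norm_of_nonneg (wnorm_nonneg _ _)]
  exact (wnorm_postCov_le hSig0 σ _ _).trans (hs _ hω)

/-- The expected regret of a round is at most `α` times the expected posterior width of the action
taken, plus the tail. -/
lemma IsOptimistic.integral_regret_round_le {hSig0 : Sig0.PosDef}
    (ho : IsOptimistic μ n theta0 hSig0 σ α F A Y)
    (hb : IsLinearBandit μ n theta0 Sig0 σ F θs A Y ε)
    (hσ : 0 < σ) (hA : IsHistoryBased μ n θs A Y) {t : ℕ} (ht : t < n) {C s : ℝ}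
    (hC : ∀ a ∈ F t, ‖a‖ ≤ C) (hs : ∀ a ∈ F t, wnorm Sig0 a ≤ s) (hτ : 0 ≤ τ)
    (hT : ∃ T : Hist d t × Vec d → ℝ, IsTailBound theta0 Sig0 σ α τ (F t) T)
    (hAstar : ∀ᵐ ω ∂μ, IsArgmax (F t) (fun a => inner ℝ a (θs ω)) (Astar t ω)) :
    ∫ ω, bestValue (F t) (θs ω) ∂μ - ∫ ω, inner ℝ (A t ω) (θs ω) ∂μ ≤
      ∫ ω, α * wnorm (postCov Sig0 σ (history A Y t ω)) (A t ω) ∂μ + τ := by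
  obtain ⟨X, hX, hle⟩ := ho t ht
  obtain ⟨T, hT⟩ := hT
  have hH := hb.measurable_history ht.le
  obtain ⟨hTi, hTle⟩ := hT.integrable_comp hSig0 hH hX hτ
  obtain ⟨hmi, hmeq⟩ := hb.integral_inner_action hSig0 hσ hA ht hC
  have hwi := (hb.integrable_wnorm hSig0 ht hs).const_mul α
  -- `X` and the parameter have the same law
  have hlaw : μ.map X = μ.map θs := by
    have h1 := hX.map_eq
    rw [← (hb.hasCondDistrib_history hSig0 hσ hA ht.le).map_eq] at h1
    have h2 := congrArg Measure.snd h1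
    rwa [Measure.snd_map_prodMk₀ hH.aemeasurable,
      Measure.snd_map_prodMk₀ hH.aemeasurable] at h2
  have hM := continuous_bestValue hC
  have hval : ∫ ω, bestValue (F t) (θs ω) ∂μ = ∫ ω, bestValue (F t) (X ω) ∂μ := by
    rw [← integral_map hb.measurable_param.aemeasurable hM.aestronglyMeasurable, ← hlaw,
      integral_map hX.aemeasurable_snd hM.aestronglyMeasurable]
  have hXi : Integrable (fun ω => bestValue (F t) (X ω)) μ := by
    have h1 := hb.integrable_bestValue hC hAstar
    have h2 := (integrable_map_measure hM.aestronglyMeasurable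
      hb.measurable_param.aemeasurable).2 h1
    rw [← hlaw] at h2
    exact (integrable_map_measure hM.aestronglyMeasurable hX.aemeasurable_snd).1 h2
  have hmono := integral_mono_ae hXi ((hmi.add hwi).add hTi) (hle τ T hT)
  rw [integral_add' (hmi.add hwi) hTi, integral_add' hmi hwi] at hmono
  rw [hval, hmeq]
  linarith

/-- The regret bound for an optimistic algorithm, with general width `α` and tail mass `τ`. -/
theorem IsOptimistic.integral_regret_le {hSig0 : Sig0.PosDef}
    (ho : IsOptimistic μ n theta0 hSig0 σ α F A Y)
    (hb : IsLinearBandit μ n theta0 Sig0 σ F θs A Y ε)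
    (hσ : 0 < σ) (hA : IsHistoryBased μ n θs A Y) {C s : ℝ}
    (hC : ∀ t < n, ∀ a ∈ F t, ‖a‖ ≤ C) (hs : ∀ t < n, ∀ a ∈ F t, wnorm Sig0 a ≤ s)
    (hs0 : 0 ≤ s) (hα : 0 ≤ α) (hτ : 0 ≤ τ)
    (hT : ∀ t < n, ∃ T : Hist d t × Vec d → ℝ, IsTailBound theta0 Sig0 σ α τ (F t) T)
    (hAstar : ∀ t < n, ∀ᵐ ω ∂μ, IsArgmax (F t) (fun a => inner ℝ a (θs ω)) (Astar t ω)) :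
    Integrable (regret n θs Astar A) μ ∧
      ∫ ω, regret n θs Astar A ω ∂μ ≤
        α * (s * Real.sqrt (n * (d * Real.log (1 + s ^ 2 * n / (σ ^ 2 * d)) /
          Real.log (1 + s ^ 2 / σ ^ 2)))) + n * τ := by
  have hval : ∀ t ∈ Finset.range n, Integrable
      (fun ω => bestValue (F t) (θs ω) - inner ℝ (A t ω) (θs ω)) μ := fun t ht =>
    have ht := Finset.mem_range.1 ht
    (hb.integrable_bestValue (hC t ht) (hAstar t ht)).sub
      (hb.integrable_inner_action ht (hC t ht))
  have hwi : ∀ t ∈ Finset.range n, Integrable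
      (fun ω => α * wnorm (postCov Sig0 σ (history A Y t ω)) (A t ω)) μ := fun t ht =>
    have ht := Finset.mem_range.1 ht
    (hb.integrable_wnorm hSig0 ht (hs t ht)).const_mul α
  have hae : (fun ω => ∑ t ∈ Finset.range n,
      (bestValue (F t) (θs ω) - inner ℝ (A t ω) (θs ω))) =ᵐ[μ] regret n θs Astar A := by
    have : ∀ᵐ ω ∂μ, ∀ t ∈ Finset.range n,
        IsArgmax (F t) (fun a => inner ℝ a (θs ω)) (Astar t ω) :=
      (Finset.eventually_all (Finset.range n)).2 fun t ht => hAstar t (Finset.mem_range.1 ht)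
    filter_upwards [this] with ω hω
    exact Finset.sum_congr rfl fun t ht => by rw [(hω t ht).bestValue_eq]
  refine ⟨(integrable_finsetSum _ hval).congr hae, ?_⟩
  rw [← integral_congr_ae hae, integral_finsetSum _ hval]
  have hround : ∀ t ∈ Finset.range n,
      ∫ ω, (bestValue (F t) (θs ω) - inner ℝ (A t ω) (θs ω)) ∂μ ≤
        ∫ ω, α * wnorm (postCov Sig0 σ (history A Y t ω)) (A t ω) ∂μ + τ := by
    intro t ht
    have ht := Finset.mem_range.1 ht
    rw [integral_sub (hb.integrable_bestValue (hC t ht) (hAstar t ht))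
      (hb.integrable_inner_action ht (hC t ht))]
    exact ho.integral_regret_round_le hb hσ hA ht (hC t ht) (hs t ht) hτ (hT t ht) (hAstar t ht)
  refine (Finset.sum_le_sum hround).trans ?_
  rw [Finset.sum_add_distrib, ← integral_finsetSum _ hwi]
  simp only [Finset.sum_const, Finset.card_range, nsmul_eq_mul]
  gcongr
  set B := α * (s * Real.sqrt (n * (d * Real.log (1 + s ^ 2 * n / (σ ^ 2 * d)) /
    Real.log (1 + s ^ 2 / σ ^ 2))))
  calc ∫ ω, ∑ t ∈ Finset.range n,
        α * wnorm (postCov Sig0 σ (history A Y t ω)) (A t ω) ∂μ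
      ≤ ∫ _ : Ω, B ∂μ := by
        refine integral_mono_ae (integrable_finsetSum _ hwi) (integrable_const _) ?_
        have : ∀ᵐ ω ∂μ, ∀ t ∈ Finset.range n, A t ω ∈ F t :=
          (Finset.eventually_all (Finset.range n)).2 fun t ht =>
            hb.action_mem t (Finset.mem_range.1 ht)
        filter_upwards [this] with ω hω
        rw [← Finset.mul_sum]
        exact mul_le_mul_of_nonneg_left (sum_wnorm_le hSig0 hσ hs0 A Y ω n fun t ht =>
          hs t ht _ (hω t (Finset.mem_range.2 ht))) hα
    _ = B := by simp

end Round

/-! ### The maximal posterior width -/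

section SigmaMax

variable {Ω : Type*} {d : ℕ} {Sig0 : Matrix (Fin d) (Fin d) ℝ}

lemma sigmaMax_nonneg (n : ℕ) (Sig0 : Matrix (Fin d) (Fin d) ℝ) (σ : ℝ) (𝒜 : Set (Vec d))
    (A : ℕ → Ω → Vec d) (Y : ℕ → Ω → ℝ) (ω : Ω) : 0 ≤ sigmaMax n Sig0 σ 𝒜 A Y ω := by
  refine Real.sSup_nonneg ?_
  rintro _ ⟨a, -, t, -, rfl⟩
  exact Real.sqrt_nonneg _

/-- In every outcome `sigmaMax` dominates the prior widths, because the first round is played with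
the prior. -/
lemma wnorm_le_sigmaMax (hSig0 : Sig0.PosDef) {n : ℕ} (hn : 0 < n) (σ : ℝ) {𝒜 : Set (Vec d)}
    (h𝒜 : Bornology.IsBounded 𝒜) (A : ℕ → Ω → Vec d) (Y : ℕ → Ω → ℝ) (ω : Ω) {a : Vec d}
    (ha : a ∈ 𝒜) : wnorm Sig0 a ≤ sigmaMax n Sig0 σ 𝒜 A Y ω := by
  have hc : Continuous fun a : Vec d => wnorm Sig0 a :=
    Real.continuous_sqrt.comp (Continuous.dotProduct (by fun_prop)
      (continuous_const.matrix_mulVec (by fun_prop)))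
  obtain ⟨M, hM⟩ : BddAbove ((fun a => wnorm Sig0 a) '' 𝒜) :=
    (h𝒜.isCompact_closure.bddAbove_image hc.continuousOn).mono
      (Set.image_mono subset_closure)
  refine le_csSup ⟨M, ?_⟩ ⟨a, ha, 0, hn, by rw [postCov_zero hSig0]⟩
  rintro _ ⟨b, hb, t, -, rfl⟩
  exact (wnorm_postCov_le hSig0 σ _ _).trans (hM (Set.mem_image_of_mem _ hb))

end SigmaMax

end BayesLinBandit

end

open BayesLinBandit in
theorem mainTheorem2 {Ω : Type*} [MeasurableSpace Ω] (μ : Measure Ω) [IsProbabilityMeasure μ]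
    {d : ℕ} (n : ℕ) (theta0 : BayesLinBandit.Vec d) (Sig0 : Matrix (Fin d) (Fin d) ℝ)
    (hSig0 : Sig0.PosDef) (σ : ℝ) (hσ : 0 < σ)
    (𝒜 : Set (BayesLinBandit.Vec d)) (h𝒜 : Bornology.IsBounded 𝒜)
    (F : ℕ → Set (BayesLinBandit.Vec d)) (hF : ∀ t < n, F t ⊆ 𝒜)
    (θs : Ω → BayesLinBandit.Vec d) (A : ℕ → Ω → BayesLinBandit.Vec d) (Y ε : ℕ → Ω → ℝ)
    (hbandit : BayesLinBandit.IsLinearBandit μ n theta0 Sig0 σ F θs A Y ε)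
    (Astar : ℕ → Ω → BayesLinBandit.Vec d)
    (hAstar : ∀ t < n, ∀ᵐ ω ∂μ,
      BayesLinBandit.IsArgmax (F t) (fun a => inner ℝ a (θs ω)) (Astar t ω))
    (δ : ℝ) (hδ : 0 < δ) :
    ((BayesLinBandit.IsLinTS μ n theta0 Sig0 σ F θs A Y ∨
        BayesLinBandit.IsLinUCB μ n theta0 Sig0 σ (Real.sqrt (2 * d * Real.log (1 / δ)))
          F θs A Y) →
      Integrable (BayesLinBandit.regret n θs Astar A) μ ∧
      ∀ ω, ∀ s, s = BayesLinBandit.sigmaMax n Sig0 σ 𝒜 A Y ω →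
        ∫ ω', BayesLinBandit.regret n θs Astar A ω' ∂μ ≤
          s * d * Real.sqrt (2 * n / Real.log (1 + s ^ 2 / σ ^ 2) *
              Real.log (1 + s ^ 2 * n / (σ ^ 2 * d)) * Real.log (1 / δ)) +
            Real.sqrt (2 / Real.pi) * s * (d : ℝ) ^ (3 / 2 : ℝ) * n * δ) ∧
    (∀ K : ℕ, (∀ t < n, (F t).encard ≤ K) →
      (BayesLinBandit.IsLinTS μ n theta0 Sig0 σ F θs A Y ∨
        BayesLinBandit.IsLinUCB μ n theta0 Sig0 σ (Real.sqrt (2 * Real.log (1 / δ)))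
          F θs A Y) →
      Integrable (BayesLinBandit.regret n θs Astar A) μ ∧
      ∀ ω, ∀ s, s = BayesLinBandit.sigmaMax n Sig0 σ 𝒜 A Y ω →
        ∫ ω', BayesLinBandit.regret n θs Astar A ω' ∂μ ≤
          s * Real.sqrt (2 * d * n / Real.log (1 + s ^ 2 / σ ^ 2) *
              Real.log (1 + s ^ 2 * n / (σ ^ 2 * d)) * Real.log (1 / δ)) +
            Real.sqrt (2 / Real.pi) * s * K * n * δ) := by

  obtain ⟨C, hC⟩ := h𝒜.exists_norm_le
  have hCF : ∀ t < n, ∀ a ∈ F t, ‖a‖ ≤ C := fun t ht a ha => hC a (hF t ht ha)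
  have hsF : ∀ ω, ∀ t < n, ∀ a ∈ F t, wnorm Sig0 a ≤ sigmaMax n Sig0 σ 𝒜 A Y ω :=
    fun ω t ht a ha =>
      wnorm_le_sigmaMax hSig0 (Nat.zero_le t |>.trans_lt ht) σ h𝒜 A Y ω (hF t ht ha)
  have hs0 : ∀ ω, 0 ≤ sigmaMax n Sig0 σ 𝒜 A Y ω := sigmaMax_nonneg n Sig0 σ 𝒜 A Y
  obtain ⟨ω₀⟩ : Nonempty Ω := μ.nonempty_of_neZero
  -- this factor is nonnegative, so the root of its product with `log (1 / δ)` splits for any `δ`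
  have hQ : ∀ s : ℝ, 0 ≤ n * (d * Real.log (1 + s ^ 2 * n / (σ ^ 2 * d)) /
      Real.log (1 + s ^ 2 / σ ^ 2)) := by
    intro s
    have h1 : 0 ≤ s ^ 2 * n / (σ ^ 2 * d) := by positivity
    have h2 : 0 ≤ s ^ 2 / σ ^ 2 := by positivity
    have h3 := Real.log_nonneg (by linarith : 1 ≤ 1 + s ^ 2 * n / (σ ^ 2 * d))
    have h4 := Real.log_nonneg (by linarith : 1 ≤ 1 + s ^ 2 / σ ^ 2)
    positivity
  have hreg : ∀ α, (IsLinTS μ n theta0 Sig0 σ F θs A Y ∨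
      IsLinUCB μ n theta0 Sig0 σ α F θs A Y) →
      IsHistoryBased μ n θs A Y ∧ IsOptimistic μ n theta0 hSig0 σ α F A Y := by
    rintro α (h | h)
    · exact ⟨h.isHistoryBased, h.isOptimistic hSig0⟩
    · exact ⟨h.isHistoryBased, h.isOptimistic hSig0 hσ hbandit hAstar⟩
  constructor
  · intro halg
    obtain ⟨hA, ho⟩ := hreg _ halg
    have key := fun ω => ho.integral_regret_le hbandit hσ hA hCF (hsF ω) (hs0 ω)
      (Real.sqrt_nonneg _) (by have := hs0 ω; positivity)
      (fun t ht => exists_isTailBound_bounded t theta0 hSig0 σ (hsF ω t ht) (hs0 ω) hδ) hAstar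
    refine ⟨(key ω₀).1, ?_⟩
    rintro ω s rfl
    refine (key ω).2.trans (le_of_eq ?_)
    set s := sigmaMax n Sig0 σ 𝒜 A Y ω
    have hsd : 0 ≤ s * d := mul_nonneg (hs0 ω) (Nat.cast_nonneg d)
    congr 1
    · rw [mul_left_comm, ← Real.sqrt_mul' _ (hQ s), mul_assoc s (d : ℝ),
        ← Real.sqrt_sq (Nat.cast_nonneg d : (0 : ℝ) ≤ d), ← Real.sqrt_mul (by positivity),
        Real.sqrt_sq (Nat.cast_nonneg d)]
      congr 2
      ring
    · ring
  · intro K hK halg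
    obtain ⟨hA, ho⟩ := hreg _ halg
    have key := fun ω => ho.integral_regret_le hbandit hσ hA hCF (hsF ω) (hs0 ω)
      (Real.sqrt_nonneg _) (by have := hs0 ω; positivity)
      (fun t ht => exists_isTailBound_finite t theta0 hSig0 σ (hsF ω t ht) (hK t ht) (hs0 ω) hδ)
      hAstar
    refine ⟨(key ω₀).1, ?_⟩
    rintro ω s rfl
    refine (key ω).2.trans (le_of_eq ?_)
    congr 1
    · rw [mul_left_comm, ← Real.sqrt_mul' _ (hQ _)]
      congr 2
      ring
    · ring
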